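/- All Hilbert spaces are complex, inner products are linear in the first argument, $\mathcal H^*$ denotes the anti-dual of a Hilbert space $\mathcal H$ (bounded conjugate-linear functionals), and $\mathcal R_{\mathcal H}:\mathcal H\to\mathcal H^*$, $\langle \mathcal R_{\mathcal H}g,x\rangle=\langle g,x\rangle_{\mathcal H}$, is the Riesz isomorphism. **Setting.** Let $A:\mathcal X\supset\operatorname{dom}A\to\mathcal Y$ and $B:\mathcal Y\supset\operatorname{dom}B\to\mathcal X$ be closed, densely defined linear operators between Hilbert spaces such that $S=A^*A$ is uniformly positive (there is $c>0$ with $\langle Sx,x\rangle\ge c\|x\|^2$ on $\operatorname{dom}S$) and $A^*\subset -B$. Let $\mathcal X_h=\operatorname{dom}A$ with inner product $\langle Ax,Ay\rangle_{\mathcal Y}$, let $\mathcal Z_h=\mathcal X_h\times\mathcal X$, and let $\mathcal A$ be the operator in $\mathcal Z_h$ given by $$\operatorname{dom}\mathcal A=\{(z_1,z_2)\in\mathcal X_h\times\mathcal X_h: Az_1\in\operatorname{dom}B\},\qquad \mathcal A(z_1,z_2)=(z_2,BAz_1).$$ Put $\mathcal A_0=\mathcal A^*$. Let $\mathcal G_1,\mathcal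 G_2$ be Hilbert spaces and $\Lambda=(\Lambda_1,\Lambda_2):\operatorname{dom}A\to\mathcal G_1\times\mathcal G_2^*$, $\Pi=(\Pi_1,\Pi_2):\operatorname{dom}B\to\mathcal G_1^*\times\mathcal G_2$ a boundary triplet for the dual pair $(A^*,-B^*)$, i.e. $\Lambda,\Pi$ are linear and surjective and $$-\langle By,x\rangle_{\mathcal X}-\langle y,Ax\rangle_{\mathcal Y}=\langle\Pi_1y,\Lambda_1x\rangle_{\mathcal G_1^*,\mathcal G_1}-\langle\Pi_2y,\Lambda_2x\rangle_{\mathcal G_2,\mathcal G_2^*}\qquad(x\in\operatorname{dom}A,\ y\in\operatorname{dom}B).$$ Put $\mathcal G=\mathcal G_1\times\mathcal G_2$ and, for $z\in\operatorname{dom}\mathcal A$, $\Gamma_0z=(\Lambda_1z_2,\Pi_2Az_1)\in\mathcal G$ and $\Gamma_1z=(-\Pi_1Az_1,\Lambda_2z_2)\in\mathcal G^*=\mathcal G_1^*\times\mathcal G_2^*$. **Nodes.** A colligation $\Theta=(G,L,K)$ on Hilbert spaces $(\mathcal U,\mathcal Z,\mathcal W)$ consists of linear maps $G,L,K$ with a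 common domain in $\mathcal Z$ and with values in $\mathcal U,\mathcal Z,\mathcal W$. It is a boundary node if the combined operator $(G,L,K)$ is closed, $G$ is surjective, $\ker G$ is dense in $\mathcal Z$ and $L|_{\ker G}$ has non-empty resolvent set; it is internally well-posed if moreover $L|_{\ker G}$ generates a strongly continuous semigroup. It is scattering passive if it is an internally well-posed boundary node and all smooth solutions on $[0,\infty)$ of $u=Gz$, $\dot z=Lz$, $y=Kz$ (that is, $u\in C^2$, $z\in C^1$ in $\mathcal Z$, and $z$ continuous in $\operatorname{dom}\Theta$ for the graph norm of $(G,L,K)$) satisfy $\frac{d}{dt}\|z(t)\|^2+\|y(t)\|^2\le\|u(t)\|^2$; it is scattering energy-preserving if equality holds. For $\mathcal W=\mathcal U$ and $\operatorname{Re}\beta>0$ the external Cayley transform is $\Theta^{(\beta)}=\big(\tfrac{1}{\sqrt{2\operatorname{Re}\beta}}(\beta G+K),\,L,\,\tfrac1{\sqrt{2\operatorname{Re}\beta}}(\overline\beta G-K)\big)$ with the same domain. $\Theta$ is impedance passive (impedance energy-preserving) if $\Theta^{(\beta)}$ is a scattering passive (scattering energy-preserving) boundary node for some $\beta$ with $\operatorname{Re}\beta>0$.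 **Statement.** One has $\mathcal A_0^*=\mathcal A$. Let $P\in L(\mathcal G^*)$ and let $N$ be the colligation on $(\mathcal G^*,\mathcal Z_h,\mathcal G^*)$ with domain $\operatorname{dom}\mathcal A_0^*$ and $$N=\Big(\tfrac1{\sqrt2}(\mathcal R_{\mathcal G}\Gamma_0+\Gamma_1),\ \mathcal A_0^*,\ -\tfrac1{\sqrt2}P(\mathcal R_{\mathcal G}\Gamma_0-\Gamma_1)\Big).$$ Then its external Cayley transform with parameter $\beta=1$ is $$N^{(1)}=\Big(\tfrac12\big((1-P)\mathcal R_{\mathcal G}\Gamma_0+(1+P)\Gamma_1\big),\ \mathcal A_0^*,\ \tfrac12\big((1+P)\mathcal R_{\mathcal G}\Gamma_0+(1-P)\Gamma_1\big)\Big).$$ If $\|P\|\le1$, then $N^{(1)}$ is an internally well-posed boundary node and it is impedance passive. If $P$ is unitary, then $N^{(1)}$ is impedance energy-preserving. -/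

import Mathlib

open Set Filter Topology
open scoped NNReal ComplexConjugate LinearPMap

noncomputable section

/-! ### Anti-duals of complex Hilbert spaces -/

/-- The anti-dual of a complex Hilbert space: bounded conjugate-linear functionals, with the
operator norm.  The duality pairing `⟨f, x⟩` is `f x`. -/
abbrev AntiDual (H : Type*) [NormedAddCommGroup H] [InnerProductSpace ℂ H] : Type _ :=
  H →L⋆[ℂ] ℂ

/-- The linear Riesz isomorphism `H → H*`, `⟨R g, x⟩ = ⟨g, x⟩_H` (linear in `g`, conjugate-linear
in `x`; Mathlib's `inner` is conjugate-linear in its first argument). -/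
def riesz (H : Type*) [NormedAddCommGroup H] [InnerProductSpace ℂ H] [CompleteSpace H] :
    H ≃ₗᵢ[ℂ] AntiDual H :=
  LinearIsometryEquiv.ofSurjective
    { toLinearMap := (innerSLFlip ℂ : H →L[ℂ] AntiDual H).toLinearMap
      norm_map' := by
        intro g
        apply le_antisymm
        · refine ContinuousLinearMap.opNorm_le_bound _ (norm_nonneg g) (fun x => ?_)
          simpa [mul_comm] using norm_inner_le_norm (𝕜 := ℂ) x g
        · by_cases hg : g = 0
          · simp [hg]
          · have h := ContinuousLinearMap.le_opNorm (innerSLFlip ℂ g : AntiDual H) g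
            have hpos : 0 < ‖g‖ := norm_pos_iff.2 hg
            have h2 : ‖(innerSLFlip ℂ g : AntiDual H) g‖ = ‖g‖ * ‖g‖ := by
              simp [inner_self_eq_norm_sq_to_K, pow_two]
            rw [h2] at h
            exact le_of_mul_le_mul_right h hpos }
    (by
      intro f
      let f' : StrongDual ℂ H :=
        { toFun := fun x => conj (f x)
          map_add' := by intro x y; simp
          map_smul' := by intro c x; simp
          cont := by fun_prop }
      refine ⟨(InnerProductSpace.toDual ℂ H).symm f', ?_⟩
      ext x
      have h : inner ℂ ((InnerProductSpace.toDual ℂ H).symm f') x = f' x :=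
        InnerProductSpace.toDual_symm_apply
      change inner ℂ x ((InnerProductSpace.toDual ℂ H).symm f') = f x
      rw [← inner_conj_symm, h]
      simp [f'])

theorem riesz_apply {H : Type*} [NormedAddCommGroup H] [InnerProductSpace ℂ H] [CompleteSpace H]
    (g x : H) : riesz H g x = inner ℂ x g := rfl

/-- The anti-dual is a Hilbert space for its operator norm; the inner product is transported by
the Riesz isomorphism. -/
instance AntiDual.instInnerProductSpace (H : Type*) [NormedAddCommGroup H]
    [InnerProductSpace ℂ H] [CompleteSpace H] : InnerProductSpace ℂ (AntiDual H) where
  toNormedSpace := inferInstance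
  inner f g := inner ℂ ((riesz H).symm f) ((riesz H).symm g)
  norm_sq_eq_re_inner f := by
    rw [← (riesz H).symm.norm_map f]
    exact norm_sq_eq_re_inner (𝕜 := ℂ) ((riesz H).symm f)
  conj_inner_symm f g := inner_conj_symm _ _
  add_left f g h := by simp
  smul_left f g c := by simp [mul_comm]

/-- The canonical identification of `G₁* × G₂*` with the anti-dual of the product Hilbert space:
`⟨(f₁, f₂), (g₁, g₂)⟩ = ⟨f₁, g₁⟩ + ⟨f₂, g₂⟩`. -/
def antiDualProd (G₁ G₂ : Type*) [NormedAddCommGroup G₁] [InnerProductSpace ℂ G₁]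
    [NormedAddCommGroup G₂] [InnerProductSpace ℂ G₂] :
    (AntiDual G₁ × AntiDual G₂) →ₗ[ℂ] AntiDual (WithLp 2 (G₁ × G₂)) where
  toFun f := f.1.comp (WithLp.fstL 2 ℂ G₁ G₂) + f.2.comp (WithLp.sndL 2 ℂ G₁ G₂)
  map_add' f g := by
    ext x
    simp [add_add_add_comm]
  map_smul' c f := by
    ext x
    simp

/-! ### Semigroups, resolvents, boundary nodes -/

section Nodes

variable {X : Type*} [NormedAddCommGroup X] [InnerProductSpace ℂ X]

/-- A strongly continuous semigroup of bounded operators on `X`. -/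
structure IsC0Semigroup (T : ℝ≥0 → X →L[ℂ] X) : Prop where
  zero : T 0 = 1
  add : ∀ s t, T (s + t) = T s * T t
  cont : ∀ x, Continuous fun t => T t x

/-- `A` generates a strongly continuous semigroup: `x ∈ dom A` and `A x = y` exactly when
`(T(h) x - x) / h → y` as `h → 0+`. -/
def GeneratesC0Semigroup (A : X →ₗ.[ℂ] X) : Prop :=
  ∃ T : ℝ≥0 → X →L[ℂ] X, IsC0Semigroup T ∧
    ∀ x y : X, (x, y) ∈ A.graph ↔
      Tendsto (fun h : ℝ≥0 => ((h : ℂ)⁻¹) • (T h x - x)) (𝓝[>] 0) (𝓝 y)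

/-- The resolvent set: those `μ` for which `μ - A : dom A → X` is bijective with a bounded
inverse `R`. -/
def resolventSetPMap (A : X →ₗ.[ℂ] X) : Set ℂ :=
  {μ | ∃ R : X →L[ℂ] X,
    (∀ x : X, ∃ h : R x ∈ A.domain, μ • R x - A ⟨R x, h⟩ = x) ∧
    ∀ x : A.domain, R (μ • (x : X) - A x) = x}

end Nodes

/-- A colligation on Hilbert spaces `(U, X, Y)`: linear maps `G, L, K` with a common domain in
`X`, with values in `U`, `X`, `Y`. -/
structure Colligation (U X Y : Type*)
    [NormedAddCommGroup U] [InnerProductSpace ℂ U] [CompleteSpace U]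
    [NormedAddCommGroup X] [InnerProductSpace ℂ X] [CompleteSpace X]
    [NormedAddCommGroup Y] [InnerProductSpace ℂ Y] [CompleteSpace Y] where
  /-- the common domain -/
  dom : Submodule ℂ X
  /-- the input boundary operator -/
  G : dom →ₗ[ℂ] U
  /-- the interior operator -/
  L : dom →ₗ[ℂ] X
  /-- the output boundary operator -/
  K : dom →ₗ[ℂ] Y

namespace Colligation

variable {U X Y : Type*}
  [NormedAddCommGroup U] [InnerProductSpace ℂ U] [CompleteSpace U]
  [NormedAddCommGroup X] [InnerProductSpace ℂ X] [CompleteSpace X]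
  [NormedAddCommGroup Y] [InnerProductSpace ℂ Y] [CompleteSpace Y]

/-- The combined operator `[G; L; K] : X ⊃ dom → U × X × Y`. -/
def combined (Θ : Colligation U X Y) : X →ₗ.[ℂ] (U × X × Y) :=
  ⟨Θ.dom, Θ.G.prod (Θ.L.prod Θ.K)⟩

/-- The main operator: the restriction of `L` to `ker G`. -/
def mainOp (Θ : Colligation U X Y) : X →ₗ.[ℂ] X :=
  (⟨Θ.dom, Θ.L⟩ : X →ₗ.[ℂ] X).domRestrict ((LinearMap.ker Θ.G).map Θ.dom.subtype)

/-- Boundary nodes. -/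
structure IsBoundaryNode (Θ : Colligation U X Y) : Prop where
  closed : Θ.combined.IsClosed
  surjective : Function.Surjective Θ.G
  dense_ker : Dense (((LinearMap.ker Θ.G).map Θ.dom.subtype : Submodule ℂ X) : Set X)
  resolvent : (resolventSetPMap Θ.mainOp).Nonempty

/-- Internally well-posed boundary nodes (in the forward time direction). -/
structure IsInternallyWellPosed (Θ : Colligation U X Y) : Prop extends Θ.IsBoundaryNode where
  generates : GeneratesC0Semigroup Θ.mainOp

/-- Smooth solutions on `[0, ∞)` of `u = G z`, `z' = L z`, `y = K z`: the input `u` is `C²`, the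
state `z` is `C¹` in `X` and continuous in `dom Θ` with the graph norm of `[G; L; K]` (that is,
`z`, `G z`, `L z` and `K z` are continuous).  The values of the functions at negative times are
irrelevant. -/
structure IsSmoothSolution (Θ : Colligation U X Y) (u : ℝ → U) (z : ℝ → Θ.dom) (y : ℝ → Y) :
    Prop where
  input_smooth : ContDiffOn ℝ 2 u (Ici 0)
  state_smooth : ContDiffOn ℝ 1 (fun t => (z t : X)) (Ici 0)
  cont_G : ContinuousOn (fun t => Θ.G (z t)) (Ici 0)
  cont_L : ContinuousOn (fun t => Θ.L (z t)) (Ici 0)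
  cont_K : ContinuousOn (fun t => Θ.K (z t)) (Ici 0)
  input_eq : ∀ t ∈ Ici (0 : ℝ), u t = Θ.G (z t)
  state_eq : ∀ t ∈ Ici (0 : ℝ), HasDerivWithinAt (fun s => (z s : X)) (Θ.L (z t)) (Ici 0) t
  output_eq : ∀ t ∈ Ici (0 : ℝ), y t = Θ.K (z t)

/-- Scattering passive boundary nodes: internally well-posed, and every smooth solution satisfies
`d/dt ‖z‖² + ‖y‖² ≤ ‖u‖²`.  (The derivative exists because `z` is `C¹`; at `t = 0` it is the
right derivative.) -/
def IsScatteringPassive (Θ : Colligation U X Y) : Prop :=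
  Θ.IsInternallyWellPosed ∧
    ∀ (u : ℝ → U) (z : ℝ → Θ.dom) (y : ℝ → Y), Θ.IsSmoothSolution u z y →
      ∀ t ∈ Ici (0 : ℝ),
        derivWithin (fun s => ‖(z s : X)‖ ^ 2) (Ici 0) t + ‖y t‖ ^ 2 ≤ ‖u t‖ ^ 2

/-- Scattering energy-preserving boundary nodes: equality in the energy balance. -/
def IsScatteringEnergyPreserving (Θ : Colligation U X Y) : Prop :=
  Θ.IsInternallyWellPosed ∧
    ∀ (u : ℝ → U) (z : ℝ → Θ.dom) (y : ℝ → Y), Θ.IsSmoothSolution u z y →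
      ∀ t ∈ Ici (0 : ℝ),
        derivWithin (fun s => ‖(z s : X)‖ ^ 2) (Ici 0) t + ‖y t‖ ^ 2 = ‖u t‖ ^ 2

/-- The external Cayley transform with parameter `β` (used for `0 < Re β`). -/
def cayley (β : ℂ) (Θ : Colligation U X U) : Colligation U X U where
  dom := Θ.dom
  G := ((Real.sqrt (2 * β.re) : ℂ)⁻¹) • (β • Θ.G + Θ.K)
  L := Θ.L
  K := ((Real.sqrt (2 * β.re) : ℂ)⁻¹) • (conj β • Θ.G - Θ.K)

/-- Impedance passive colligations. -/
def IsImpedancePassive (Θ : Colligation U X U) : Prop :=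
  ∃ β : ℂ, 0 < β.re ∧ (Θ.cayley β).IsScatteringPassive

/-- Impedance energy-preserving colligations. -/
def IsImpedanceEnergyPreserving (Θ : Colligation U X U) : Prop :=
  ∃ β : ℂ, 0 < β.re ∧ (Θ.cayley β).IsScatteringEnergyPreserving

end Colligation

/-! ### Abstract second order systems -/

/-- The operator `S = A* A`, with `dom S = {x ∈ dom A | A x ∈ dom A*}`. -/
def stiffness {X Y : Type*} [NormedAddCommGroup X] [InnerProductSpace ℂ X] [CompleteSpace X]
    [NormedAddCommGroup Y] [InnerProductSpace ℂ Y] (A : X →ₗ.[ℂ] Y) : X →ₗ.[ℂ] X where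
  domain := (A†.domain.comap A.toFun).map A.domain.subtype
  toFun :=
    A†.toFun.comp
      ((A.toFun.comp (Submodule.inclusion (Submodule.map_subtype_le A.domain _))).codRestrict
        A†.domain (by
          rintro ⟨_, x, hx, rfl⟩
          exact hx))

/-- Uniform positivity (coercivity) of an operator. -/
def IsUniformlyPositive {X : Type*} [NormedAddCommGroup X] [InnerProductSpace ℂ X]
    (P : X →ₗ.[ℂ] X) : Prop :=
  ∃ c : ℝ, 0 < c ∧ ∀ x : P.domain, c * ‖(x : X)‖ ^ 2 ≤ (inner ℂ (x : X) (P x)).re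

/-- The operators of a second order system with boundary: `A : X ⊃ dom A → Y` and
`B : Y ⊃ dom B → X` are closed and densely defined, `S = A* A` is uniformly positive, and
`A* ⊂ -B`, i.e. `(A*, -B*)` is a dual pair. -/
structure SecondOrderSystem (X Y : Type*)
    [NormedAddCommGroup X] [InnerProductSpace ℂ X] [CompleteSpace X]
    [NormedAddCommGroup Y] [InnerProductSpace ℂ Y] [CompleteSpace Y] where
  A : X →ₗ.[ℂ] Y
  B : Y →ₗ.[ℂ] X
  A_closed : A.IsClosed
  A_dense : Dense (A.domain : Set X)
  B_closed : B.IsClosed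
  B_dense : Dense (B.domain : Set Y)
  stiffness_pos : IsUniformlyPositive (stiffness A)
  adjoint_le : A† ≤ -B

namespace SecondOrderSystem

variable {X Y : Type*}
  [NormedAddCommGroup X] [InnerProductSpace ℂ X] [CompleteSpace X]
  [NormedAddCommGroup Y] [InnerProductSpace ℂ Y] [CompleteSpace Y]

theorem exists_coercive (S : SecondOrderSystem X Y) :
    ∃ c : ℝ, 0 < c ∧ ∀ x : S.A.domain, ∀ w : X,
      (∀ v : S.A.domain, inner ℂ w (v : X) = inner ℂ (S.A x) (S.A v)) →
        c * ‖(x : X)‖ ^ 2 ≤ ‖S.A x‖ ^ 2 := by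
  obtain ⟨c, hc, h⟩ := S.stiffness_pos
  refine ⟨c, hc, fun x w hw => ?_⟩
  have hx : S.A x ∈ (S.A)†.domain := LinearPMap.mem_adjoint_domain_of_exists _ ⟨w, hw⟩
  have hxS : (x : X) ∈ (stiffness S.A).domain := ⟨x, hx, rfl⟩
  have h1 := h ⟨x, hxS⟩
  have h2 : (stiffness S.A) ⟨x, hxS⟩ = (S.A)† ⟨S.A x, hx⟩ := rfl
  have h3 := LinearPMap.adjoint_isFormalAdjoint S.A_dense ⟨S.A x, hx⟩ x
  rw [h2, ← inner_conj_symm, Complex.conj_re, h3] at h1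
  refine h1.trans (le_of_eq ?_)
  exact inner_self_eq_norm_sq (𝕜 := ℂ) (S.A x)

/-- Coercivity of `S = A* A` passes to `A`. -/
theorem A_bounded_below (S : SecondOrderSystem X Y) :
    ∃ c : ℝ, 0 < c ∧ ∀ x : S.A.domain, c * ‖(x : X)‖ ^ 2 ≤ ‖S.A x‖ ^ 2 := by
  obtain ⟨c, hc, h⟩ := S.exists_coercive
  refine ⟨c, hc, ?_⟩
  let e := (WithLp.linearEquiv 2 ℂ (X × Y))
  let K : Submodule ℂ (WithLp 2 (X × Y)) := S.A.graph.comap e.toLinearMap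
  have hKc : IsClosed (K : Set (WithLp 2 (X × Y))) :=
    IsClosed.preimage (WithLp.prod_continuous_ofLp 2 X Y) S.A_closed
  have : CompleteSpace K := hKc.completeSpace_coe
  have hmem : ∀ v : S.A.domain, (WithLp.toLp 2 ((v : X), S.A v) : WithLp 2 (X × Y)) ∈ K :=
    fun v => LinearPMap.mem_graph S.A v
  let D : Submodule ℂ K :=
    { carrier := {p | ∃ w : X, ∀ v : S.A.domain,
        inner ℂ w (v : X) = inner ℂ (p : WithLp 2 (X × Y)).snd (S.A v)}
      add_mem' := by
        rintro a b ⟨w, hw⟩ ⟨w', hw'⟩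
        exact ⟨w + w', fun v => by simp [hw, hw']⟩
      zero_mem' := ⟨0, fun v => by simp⟩
      smul_mem' := by
        rintro r a ⟨w, hw⟩
        exact ⟨r • w, fun v => by simp [hw]⟩ }
  have hD : Dense (D : Set K) := by
    rw [Submodule.dense_iff_topologicalClosure_eq_top, Submodule.topologicalClosure_eq_top_iff,
      Submodule.eq_bot_iff]
    intro q hq
    obtain ⟨v, hv1, hv2⟩ := (LinearPMap.mem_graph_iff S.A).1 q.2
    have key : ∀ g : X, inner ℂ g (v : X) = 0 := by
      intro g
      let p := K.orthogonalProjectionOnto (WithLp.toLp 2 (g, (0 : Y)))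
      have horth : ∀ k ∈ K,
          inner ℂ ((WithLp.toLp 2 (g, (0 : Y)) : WithLp 2 (X × Y)) - p) k = 0 :=
        fun k hk => Submodule.starProjection_inner_eq_zero _ k hk
      have hw : ∀ u : S.A.domain, inner ℂ (g - (p : WithLp 2 (X × Y)).fst) (u : X)
          = inner ℂ (p : WithLp 2 (X × Y)).snd (S.A u) := by
        intro u
        have := horth _ (hmem u)
        simp only [WithLp.prod_inner_apply, WithLp.ofLp_sub, Prod.fst_sub, Prod.snd_sub,
          zero_sub, inner_neg_left] at this
        exact sub_eq_zero.1 ((sub_eq_add_neg _ _).trans this)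
      have hpD : p ∈ D := ⟨_, hw⟩
      have h0 := Submodule.inner_right_of_mem_orthogonal hpD hq
      have h1 : inner ℂ (p : WithLp 2 (X × Y)) (q : WithLp 2 (X × Y)) = 0 := h0
      rw [WithLp.prod_inner_apply] at h1
      have hq1 : (q : WithLp 2 (X × Y)).ofLp.fst = (v : X) := hv1.symm
      have hq2 : (q : WithLp 2 (X × Y)).ofLp.snd = S.A v := hv2.symm
      rw [hq1, hq2] at h1
      have h2 := hw v
      rw [inner_sub_left, sub_eq_iff_eq_add] at h2
      rw [h2, add_comm]
      exact h1
    have hv0 : (v : X) = 0 := inner_self_eq_zero.1 (key v)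
    have hv0' : v = 0 := Subtype.ext hv0
    apply Subtype.ext
    apply (WithLp.linearEquiv 2 ℂ (X × Y)).injective
    refine Prod.ext ?_ ?_
    · exact hv1.symm.trans hv0
    · refine hv2.symm.trans ?_
      rw [hv0']
      exact S.A.map_zero
  have hclosed : IsClosed {p : K | c * ‖(p : WithLp 2 (X × Y)).fst‖ ^ 2
      ≤ ‖(p : WithLp 2 (X × Y)).snd‖ ^ 2} := by
    apply isClosed_le
    · have : Continuous fun p : K => (p : WithLp 2 (X × Y)).fst :=
        (WithLp.fstL 2 ℂ X Y).continuous.comp continuous_subtype_val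
      fun_prop
    · have : Continuous fun p : K => (p : WithLp 2 (X × Y)).snd :=
        (WithLp.sndL 2 ℂ X Y).continuous.comp continuous_subtype_val
      fun_prop
  have hsub : (D : Set K) ⊆ {p : K | c * ‖(p : WithLp 2 (X × Y)).fst‖ ^ 2
      ≤ ‖(p : WithLp 2 (X × Y)).snd‖ ^ 2} := by
    rintro p ⟨w, hw⟩
    obtain ⟨v, hv1, hv2⟩ := (LinearPMap.mem_graph_iff S.A).1 p.2
    have hp1 : (p : WithLp 2 (X × Y)).fst = (v : X) := hv1.symm
    have hp2 : (p : WithLp 2 (X × Y)).snd = S.A v := hv2.symm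
    simp only [Set.mem_ofPred_eq, hp1, hp2]
    rw [hp2] at hw
    exact h v w hw
  intro x
  have := hclosed.closure_subset_iff.2 hsub (hD ⟨_, hmem x⟩)
  exact this

theorem A_injective (S : SecondOrderSystem X Y) : Function.Injective S.A.toFun := by
  obtain ⟨c, hc, h⟩ := S.A_bounded_below
  rw [← LinearMap.ker_eq_bot, LinearMap.ker_eq_bot']
  intro x hx
  have hx' : S.A x = 0 := hx
  have h1 := h x
  rw [hx', norm_zero, zero_pow two_ne_zero] at h1
  have h2 : ‖(x : X)‖ ^ 2 ≤ 0 := by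
    by_contra hcon
    push Not at hcon
    have := mul_pos hc hcon
    linarith
  have h3 : ‖(x : X)‖ = 0 := pow_eq_zero_iff two_ne_zero |>.1 (le_antisymm h2 (sq_nonneg _))
  exact Subtype.ext (norm_eq_zero.1 h3)

/-- The energetic space `X_h`: the vector space `dom A` with the inner product
`h(x, y) = ⟨A x, A y⟩`. -/
def EnergySpace (S : SecondOrderSystem X Y) : Type _ := S.A.domain

instance (S : SecondOrderSystem X Y) : AddCommGroup S.EnergySpace :=
  inferInstanceAs (AddCommGroup S.A.domain)

instance (S : SecondOrderSystem X Y) : Module ℂ S.EnergySpace :=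
  inferInstanceAs (Module ℂ S.A.domain)

/-- An element of `X_h` as an element of `dom A ⊂ X`. -/
def toDom (S : SecondOrderSystem X Y) : S.EnergySpace ≃ₗ[ℂ] S.A.domain :=
  LinearEquiv.refl ℂ S.A.domain

/-- `A` as a linear map on `X_h`. -/
def AE (S : SecondOrderSystem X Y) : S.EnergySpace →ₗ[ℂ] Y :=
  S.A.toFun.comp S.toDom.toLinearMap

instance (S : SecondOrderSystem X Y) : NormedAddCommGroup S.EnergySpace :=
  NormedAddCommGroup.induced S.EnergySpace Y S.AE S.A_injective

instance (S : SecondOrderSystem X Y) : InnerProductSpace ℂ S.EnergySpace where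
  toNormedSpace := NormedSpace.induced ℂ S.EnergySpace Y S.AE
  inner x y := inner ℂ (S.AE x) (S.AE y)
  norm_sq_eq_re_inner x := norm_sq_eq_re_inner (𝕜 := ℂ) (S.AE x)
  conj_inner_symm x y := inner_conj_symm _ _
  add_left x y z := by simp
  smul_left x y r := by simp [mul_comm]

/-- `A : X_h → Y` is isometric. -/
theorem AE_isometry (S : SecondOrderSystem X Y) : Isometry S.AE :=
  AddMonoidHomClass.isometry_of_norm S.AE (fun _ => rfl)

instance (S : SecondOrderSystem X Y) : CompleteSpace S.EnergySpace := by
  rw [completeSpace_iff_isComplete_range S.AE_isometry.isUniformInducing]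
  apply IsClosed.isComplete
  apply isClosed_of_closure_subset
  intro y hy
  obtain ⟨s, hs, hlim⟩ := mem_closure_iff_seq_limit.1 hy
  choose x hx using hs
  obtain ⟨c, hc, h⟩ := S.A_bounded_below
  have hb : ∀ v : S.A.domain, ‖(v : X)‖ ≤ Real.sqrt (1 / c) * ‖S.A v‖ := by
    intro v
    rw [← Real.sqrt_sq (norm_nonneg (v : X)), ← Real.sqrt_sq (norm_nonneg (S.A v)),
      ← Real.sqrt_mul (by positivity)]
    apply Real.sqrt_le_sqrt
    rw [one_div, inv_mul_eq_div, le_div_iff₀ hc, mul_comm]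
    exact h v
  have hcs : CauchySeq fun n => S.A (S.toDom (x n)) := by
    have : (fun n => S.A (S.toDom (x n))) = s := funext hx
    rw [this]
    exact hlim.cauchySeq
  have hcx : CauchySeq fun n => ((S.toDom (x n) : S.A.domain) : X) := by
    rw [Metric.cauchySeq_iff] at hcs ⊢
    intro ε hε
    obtain ⟨N, hN⟩ := hcs (ε / (Real.sqrt (1 / c) + 1)) (by positivity)
    refine ⟨N, fun m hm n hn => ?_⟩
    have h1 := hb (S.toDom (x m) - S.toDom (x n))
    have h2 := hN m hm n hn
    rw [dist_eq_norm] at h2 ⊢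
    rw [LinearPMap.map_sub] at h1
    rw [lt_div_iff₀ (by positivity)] at h2
    refine lt_of_le_of_lt h1 (lt_of_le_of_lt ?_ h2)
    rw [mul_comm]
    gcongr
    linarith
  obtain ⟨x₀, hx₀⟩ := cauchySeq_tendsto_of_complete hcx
  have hs' : Tendsto (fun n => S.A (S.toDom (x n))) atTop (𝓝 y) := by
    have : (fun n => S.A (S.toDom (x n))) = s := funext hx
    rw [this]
    exact hlim
  have hg : (x₀, y) ∈ S.A.graph :=
    S.A_closed.mem_of_tendsto (hx₀.prodMk_nhds hs')
      (Eventually.of_forall fun n => LinearPMap.mem_graph S.A _)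
  obtain ⟨v, _, hv2⟩ := (LinearPMap.mem_graph_iff S.A).1 hg
  exact ⟨S.toDom.symm v, hv2⟩

/-- The state space `Z_h = X_h × X` with the product Hilbert space norm. -/
abbrev StateSpace (S : SecondOrderSystem X Y) : Type _ := WithLp 2 (S.EnergySpace × X)

/-- `dom 𝒜 = {(z₁, z₂) ∈ X_h × X_h | A z₁ ∈ dom B}` (recall `X_h = dom A` as a set). -/
def stateDom (S : SecondOrderSystem X Y) : Submodule ℂ S.StateSpace where
  carrier := {z | S.AE z.fst ∈ S.B.domain ∧ z.snd ∈ S.A.domain}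
  add_mem' := by
    rintro a b ⟨h1, h2⟩ ⟨h3, h4⟩
    refine ⟨?_, ?_⟩
    · rw [WithLp.add_fst, map_add]
      exact add_mem h1 h3
    · rw [WithLp.add_snd]
      exact add_mem h2 h4
  zero_mem' := by
    refine ⟨?_, ?_⟩
    · rw [WithLp.zero_fst, map_zero]
      exact zero_mem _
    · rw [WithLp.zero_snd]
      exact zero_mem _
  smul_mem' := by
    rintro r a ⟨h1, h2⟩
    refine ⟨?_, ?_⟩
    · rw [WithLp.smul_fst, map_smul]
      exact Submodule.smul_mem _ _ h1
    · rw [WithLp.smul_snd]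
      exact Submodule.smul_mem _ _ h2

/-- `z ↦ A z₁`, as a map from `dom 𝒜` to `dom B`. -/
def strain (S : SecondOrderSystem X Y) : S.stateDom →ₗ[ℂ] S.B.domain :=
  ((S.AE.comp (WithLp.fstL 2 ℂ S.EnergySpace X).toLinearMap).comp
    S.stateDom.subtype).codRestrict S.B.domain (fun z => z.2.1)

/-- `z ↦ z₂`, as a map from `dom 𝒜` to `dom A`. -/
def velocity (S : SecondOrderSystem X Y) : S.stateDom →ₗ[ℂ] S.A.domain :=
  ((WithLp.sndL 2 ℂ S.EnergySpace X).toLinearMap.comp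
    S.stateDom.subtype).codRestrict S.A.domain (fun z => z.2.2)

/-- The operator `𝒜 = [0, I; B A, 0]`, `𝒜 (z₁, z₂) = (z₂, B A z₁)`, in `Z_h`. -/
def stateOp (S : SecondOrderSystem X Y) : S.StateSpace →ₗ.[ℂ] S.StateSpace where
  domain := S.stateDom
  toFun := (WithLp.linearEquiv 2 ℂ (S.EnergySpace × X)).symm.toLinearMap.comp
    ((S.toDom.symm.toLinearMap.comp S.velocity).prod (S.B.toFun.comp S.strain))

variable {G₁ G₂ : Type*}
  [NormedAddCommGroup G₁] [InnerProductSpace ℂ G₁] [CompleteSpace G₁]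
  [NormedAddCommGroup G₂] [InnerProductSpace ℂ G₂] [CompleteSpace G₂]

/-- A boundary triplet `(G₁ × G₂, Λ, Π)` for the dual pair `(A*, -B*)`: linear surjections
`Λ : dom A → G₁ × G₂*` and `Π : dom B → G₁* × G₂` with the Green identity
`-⟨B y, x⟩ - ⟨y, A x⟩ = ⟨Π₁ y, Λ₁ x⟩ - ⟨Π₂ y, Λ₂ x⟩`.
(The scalar product `⟨a, b⟩`, linear in `a`, is `inner ℂ b a`; the pairing of `g ∈ G₂` with
`f ∈ G₂*` is the conjugate of `f g`.) -/
structure DualPairTriplet (S : SecondOrderSystem X Y) (G₁ G₂ : Type*)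
    [NormedAddCommGroup G₁] [InnerProductSpace ℂ G₁] [CompleteSpace G₁]
    [NormedAddCommGroup G₂] [InnerProductSpace ℂ G₂] [CompleteSpace G₂] where
  Lam₁ : S.A.domain →ₗ[ℂ] G₁
  Lam₂ : S.A.domain →ₗ[ℂ] AntiDual G₂
  Pi₁ : S.B.domain →ₗ[ℂ] AntiDual G₁
  Pi₂ : S.B.domain →ₗ[ℂ] G₂
  Lam_surjective : Function.Surjective (Lam₁.prod Lam₂)
  Pi_surjective : Function.Surjective (Pi₁.prod Pi₂)
  green : ∀ (y : S.B.domain) (x : S.A.domain),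
    -inner ℂ (x : X) (S.B y) - inner ℂ (S.A x) (y : Y)
      = Pi₁ y (Lam₁ x) - conj (Lam₂ x (Pi₂ y))

namespace DualPairTriplet

variable {S : SecondOrderSystem X Y}

/-- `Γ₀ z = (Λ₁ z₂, Π₂ A z₁) ∈ 𝒢 = G₁ × G₂`. -/
def Γ₀ (T : S.DualPairTriplet G₁ G₂) : S.stateDom →ₗ[ℂ] WithLp 2 (G₁ × G₂) :=
  (WithLp.linearEquiv 2 ℂ (G₁ × G₂)).symm.toLinearMap.comp
    ((T.Lam₁.comp S.velocity).prod (T.Pi₂.comp S.strain))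

/-- `Γ₁ z = (-Π₁ A z₁, Λ₂ z₂) ∈ 𝒢* = G₁* × G₂*`. -/
def Γ₁ (T : S.DualPairTriplet G₁ G₂) : S.stateDom →ₗ[ℂ] AntiDual (WithLp 2 (G₁ × G₂)) :=
  (antiDualProd G₁ G₂).comp
    ((-(T.Pi₁.comp S.strain)).prod (T.Lam₂.comp S.velocity))

/-- `R_𝒢 Γ₀ : dom 𝒜 → 𝒢*`. -/
def RΓ₀ (T : S.DualPairTriplet G₁ G₂) : S.stateDom →ₗ[ℂ] AntiDual (WithLp 2 (G₁ × G₂)) :=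
  (riesz (WithLp 2 (G₁ × G₂))).toLinearEquiv.toLinearMap.comp T.Γ₀

/-- The node with input `(R Γ₀ + Γ₁) / √2`, interior operator `𝒜` and output
`-P (R Γ₀ - Γ₁) / √2`. -/
def scatteringNode (T : S.DualPairTriplet G₁ G₂)
    (P : AntiDual (WithLp 2 (G₁ × G₂)) →L[ℂ] AntiDual (WithLp 2 (G₁ × G₂))) :
    Colligation (AntiDual (WithLp 2 (G₁ × G₂))) S.StateSpace
      (AntiDual (WithLp 2 (G₁ × G₂))) where
  dom := S.stateDom
  G := ((Real.sqrt 2 : ℂ)⁻¹) • (T.RΓ₀ + T.Γ₁)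
  L := S.stateOp.toFun
  K := (-(Real.sqrt 2 : ℂ)⁻¹) • (P.toLinearMap.comp (T.RΓ₀ - T.Γ₁))

/-- The node with Robin-type input `((1 - P) R Γ₀ + (1 + P) Γ₁) / 2`, interior operator `𝒜` and
output `((1 + P) R Γ₀ + (1 - P) Γ₁) / 2`. -/
def robinNode (T : S.DualPairTriplet G₁ G₂)
    (P : AntiDual (WithLp 2 (G₁ × G₂)) →L[ℂ] AntiDual (WithLp 2 (G₁ × G₂))) :
    Colligation (AntiDual (WithLp 2 (G₁ × G₂))) S.StateSpace
      (AntiDual (WithLp 2 (G₁ × G₂))) where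
  dom := S.stateDom
  G := (2⁻¹ : ℂ) • ((1 - P).toLinearMap.comp T.RΓ₀ + (1 + P).toLinearMap.comp T.Γ₁)
  L := S.stateOp.toFun
  K := (2⁻¹ : ℂ) • ((1 + P).toLinearMap.comp T.RΓ₀ + (1 - P).toLinearMap.comp T.Γ₁)

end DualPairTriplet

end SecondOrderSystem

end

/-!
Write `a = R Γ₀` and `b = Γ₁`. The triplet turns Green's identity for `(A, B)` into
`⟪𝒜 z, w⟫ + ⟪z, 𝒜 w⟫ = ⟪a z, b w⟫ + ⟪b z, a w⟫`, with `(a, b)` onto, and `𝒜` is the negative adjoint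
of its restriction to `ker a ∩ ker b`. In particular `𝒜` is closed and
`4 Re ⟪𝒜 z, z⟫ = ‖a z + b z‖² - ‖a z - b z‖²`.

For a contraction `P`, the restriction of `𝒜` to `a + b = P (a - b)` is therefore dissipative. A
vector `w` orthogonal to the range of `1 - 𝒜` on this subspace satisfies `𝒜 w = -w`, and testing
against all admissible boundary values gives `‖a w - b w‖ ≤ ‖a w + b w‖`, hence `Re ⟪𝒜 w, w⟫ ≥ 0`
and `w = 0`. So the restriction is maximal dissipative and generates a contraction semigroup.

The external Cayley transform with parameter `1` is an involution, so impedance passivity of `N⁽¹⁾`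
is scattering passivity of `N`, whose energy balance is the formula for `4 Re ⟪𝒜 z, z⟫`.
-/

section ClosedOperators

variable {𝕜 E F : Type*} [RCLike 𝕜]
  [NormedAddCommGroup E] [InnerProductSpace 𝕜 E] [CompleteSpace E]
  [NormedAddCommGroup F] [InnerProductSpace 𝕜 F] [CompleteSpace F]

theorem mem_of_forall_mem_adjoint {g : Submodule 𝕜 (E × F)}
    (hg : IsClosed (g : Set (E × F))) {x : E} {y : F}
    (h : ∀ v w, (v, w) ∈ g.adjoint → inner 𝕜 w x = inner 𝕜 v y) : (x, y) ∈ g := by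
  let g₂ : Submodule 𝕜 (WithLp 2 (E × F)) := g.comap (WithLp.linearEquiv 2 𝕜 (E × F)).toLinearMap
  have hg₂ : IsClosed (g₂ : Set (WithLp 2 (E × F))) :=
    hg.preimage (WithLp.prod_continuous_ofLp 2 E F)
  have : CompleteSpace g₂ := hg₂.completeSpace_coe
  suffices WithLp.toLp 2 (x, y) ∈ g₂ᗮᗮ by rwa [Submodule.orthogonal_orthogonal] at this
  rintro ⟨p, q⟩ hpq
  have hqp : (q, -p) ∈ g.adjoint := by
    refine (Submodule.mem_adjoint_iff _ _).2 fun a b hab => ?_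
    simpa [WithLp.prod_inner_apply, add_comm] using hpq (WithLp.toLp 2 (a, b)) hab
  simp [WithLp.prod_inner_apply, ← h q (-p) hqp]

variable {T : E →ₗ.[𝕜] F}

theorem mem_graph_of_forall_adjoint (hc : T.IsClosed)
    (hd : Dense (T.domain : Set E)) {x : E} {y : F}
    (h : ∀ v : T†.domain, inner 𝕜 (T† v) x = inner 𝕜 (v : F) y) : (x, y) ∈ T.graph := by
  refine mem_of_forall_mem_adjoint hc fun v w hvw => ?_
  rw [← LinearPMap.adjoint_graph_eq_graph_adjoint hd] at hvw
  obtain ⟨u, rfl, rfl⟩ := (LinearPMap.mem_graph_iff _).1 hvw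
  exact h u

theorem dense_adjoint_domain (hc : T.IsClosed) (hd : Dense (T.domain : Set E)) :
    Dense (T†.domain : Set F) := by
  rw [Submodule.dense_iff_topologicalClosure_eq_top, Submodule.topologicalClosure_eq_top_iff,
    Submodule.eq_bot_iff]
  intro w hw
  have : ((0 : E), w) ∈ T.graph := mem_graph_of_forall_adjoint hc hd fun v => by
    rw [inner_zero_right, hw v v.2]
  exact T.graph_fst_eq_zero_snd this rfl

theorem adjoint_adjoint_eq_self (hc : T.IsClosed) (hd : Dense (T.domain : Set E)) :
    T†† = T := by
  have hd' := dense_adjoint_domain hc hd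
  refine le_antisymm (LinearPMap.le_of_le_graph fun ⟨x, y⟩ hxy => ?_)
    ((LinearPMap.adjoint_isFormalAdjoint hd).le_adjoint hd')
  obtain ⟨u, rfl, rfl⟩ := (LinearPMap.mem_graph_iff _).1 hxy
  exact mem_graph_of_forall_adjoint hc hd fun v => (LinearPMap.adjoint_isFormalAdjoint hd').symm v u

end ClosedOperators

section StrongConvergence

variable {𝕜 X Y ι : Type*} [NontriviallyNormedField 𝕜]
  [NormedAddCommGroup X] [NormedSpace 𝕜 X] [NormedAddCommGroup Y] [NormedSpace 𝕜 Y]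
  {F : ι → X →L[𝕜] Y} {f : X →L[𝕜] Y} {M : ℝ≥0} {l : Filter ι}

theorem tendsto_apply_of_dense (hF : ∀ i, ‖F i‖₊ ≤ M) {D : Set X} (hD : Dense D)
    (h : ∀ x ∈ D, Tendsto (F · x) l (𝓝 (f x))) (x : X) : Tendsto (F · x) l (𝓝 (f x)) := by
  have hequi : Equicontinuous fun i => (F i : X → Y) :=
    (LipschitzWith.uniformEquicontinuous _ M fun i =>
      (F i).lipschitz.weaken (hF i)).equicontinuous
  exact (hequi.isClosed_setOfPred_tendsto f.continuous).closure_subset_iff.2 h (hD x)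

theorem tendsto_apply_of_tendsto (hF : ∀ i, ‖F i‖₊ ≤ M) {x : X} {y : Y}
    (h : Tendsto (F · x) l (𝓝 y)) {u : ι → X} (hu : Tendsto u l (𝓝 x)) :
    Tendsto (fun i => F i (u i)) l (𝓝 y) := by
  have hsub : Tendsto (fun i => F i (u i - x)) l (𝓝 0) := by
    refine squeeze_zero_norm (fun i => (F i).le_of_opNorm_le (hF i) _) ?_
    simpa using (tendsto_iff_norm_sub_tendsto_zero.1 hu).const_mul (M : ℝ)
  simpa using hsub.add h

theorem cauchySeq_apply_of_dense {F : ℕ → X →L[𝕜] Y} (hF : ∀ n, ‖F n‖₊ ≤ M) {D : Set X}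
    (hD : Dense D) (h : ∀ x ∈ D, CauchySeq (F · x)) (x : X) : CauchySeq (F · x) := by
  have hcauchy (y : X) : CauchySeq (F · y) ↔
      Tendsto (fun p : ℕ × ℕ => (F p.1 - F p.2) y) atTop (𝓝 0) := by
    simp only [cauchySeq_iff_tendsto_dist_atTop_0, dist_eq_norm, sub_apply,
      ← tendsto_zero_iff_norm_tendsto_zero]
  refine (hcauchy x).2 (tendsto_apply_of_dense (f := 0) (M := M + M) (fun p => ?_) hD
    (fun y hy => (hcauchy y).1 (h y hy)) x)
  exact (nnnorm_sub_le _ _).trans (add_le_add (hF _) (hF _))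

end StrongConvergence

section BoundedDissipative

open NormedSpace

variable {X : Type*} [NormedAddCommGroup X] [InnerProductSpace ℂ X] [CompleteSpace X]
  {C D : X →L[ℂ] X} {t : ℝ}

theorem hasDerivAt_exp_smul_apply (C : X →L[ℂ] X) (x : X) (t : ℝ) :
    HasDerivAt (fun s : ℝ => exp (s • C) x) (exp (t • C) (C x)) t :=
  ((ContinuousLinearMap.apply ℂ X x).restrictScalars ℝ).hasFDerivAt.comp_hasDerivAt t
    (hasDerivAt_exp_smul_const (𝕂 := ℝ) C t)

theorem commute_exp_smul (h : Commute C D) (t : ℝ) (x : X) :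
    C (exp (t • D) x) = exp (t • D) (C x) :=
  DFunLike.congr_fun (h.smul_right t).exp_right.eq x

theorem exp_add_smul_apply (C : X →L[ℂ] X) (s t : ℝ) (x : X) :
    exp ((s + t) • C) x = exp (s • C) (exp (t • C) x) := by
  let _ : NormedAlgebra ℚ (X →L[ℂ] X) := NormedAlgebra.restrictScalars ℚ ℝ _
  rw [add_smul, exp_add_of_commute (((Commute.refl C).smul_left s).smul_right t)]
  rfl

theorem norm_exp_smul_apply_le (hC : ∀ x, (inner ℂ x (C x)).re ≤ 0) (ht : 0 ≤ t) (x : X) :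
    ‖exp (t • C) x‖ ≤ ‖x‖ := by
  let _ : InnerProductSpace ℝ X := InnerProductSpace.rclikeToReal ℂ X
  have hderiv (s : ℝ) : HasDerivAt (fun s : ℝ => ‖exp (s • C) x‖ ^ 2)
      (2 * inner ℝ (exp (s • C) x) (C (exp (s • C) x))) s := by
    rw [commute_exp_smul (Commute.refl C)]
    exact (hasDerivAt_exp_smul_apply C x s).norm_sq
  have hanti : Antitone fun s : ℝ => ‖exp (s • C) x‖ ^ 2 := by
    refine antitone_of_deriv_nonpos (fun s => (hderiv s).differentiableAt) fun s => ?_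
    rw [(hderiv s).deriv]
    exact mul_nonpos_of_nonneg_of_nonpos zero_le_two (hC _)
  exact (sq_le_sq₀ (norm_nonneg _) (norm_nonneg _)).1 (by simpa using hanti ht)

theorem nnnorm_exp_smul_le (hC : ∀ x, (inner ℂ x (C x)).re ≤ 0) (ht : 0 ≤ t) :
    ‖exp (t • C)‖₊ ≤ 1 :=
  ContinuousLinearMap.opNNNorm_le_bound _ _ fun x => by
    simpa using! norm_exp_smul_apply_le hC ht x

theorem hasDerivAt_exp_mul_exp_apply (h : Commute C D) (x : X) (t s : ℝ) :
    HasDerivAt (fun s : ℝ => exp (s • C) (exp ((t - s) • D) x))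
      (exp (s • C) (exp ((t - s) • D) (C x - D x))) s := by
  have hCexp := hasDerivAt_exp_smul_const (𝕂 := ℝ) C s
  have hDexp := (hasDerivAt_exp_smul_const' (𝕂 := ℝ) D (t - s)).scomp s
    ((hasDerivAt_id s).const_sub t)
  refine (((ContinuousLinearMap.apply ℂ X x).restrictScalars ℝ).hasFDerivAt.comp_hasDerivAt s
    (hCexp.mul hDexp)).congr_deriv ?_
  have hCx := commute_exp_smul h (t - s) x
  have hDx := commute_exp_smul (Commute.refl D) (t - s) x
  simp_all [sub_eq_add_neg]

theorem norm_exp_smul_apply_sub_le (hC : ∀ x, (inner ℂ x (C x)).re ≤ 0)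
    (hD : ∀ x, (inner ℂ x (D x)).re ≤ 0) (hCD : Commute C D) (ht : 0 ≤ t) (x : X) :
    ‖exp (t • C) x - exp (t • D) x‖ ≤ t * ‖C x - D x‖ := by
  have := norm_image_sub_le_of_norm_deriv_le_segment' (a := 0) (b := t) (C := ‖C x - D x‖)
    (fun s _ => (hasDerivAt_exp_mul_exp_apply hCD x t s).hasDerivWithinAt)
    (fun s hs => (norm_exp_smul_apply_le hC hs.1 _).trans
      (norm_exp_smul_apply_le hD (sub_nonneg.2 hs.2.le) _)) t (right_mem_Icc.2 ht)
  simpa [mul_comm] using this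

theorem norm_exp_smul_apply_sub_self_le (hC : ∀ x, (inner ℂ x (C x)).re ≤ 0) (ht : 0 ≤ t)
    (x : X) : ‖exp (t • C) x - x‖ ≤ t * ‖C x‖ := by
  simpa using norm_exp_smul_apply_sub_le (D := 0) hC (by simp) (Commute.zero_right C) ht x

theorem norm_exp_smul_apply_sub_sub_le (C : X →L[ℂ] X) {M : ℝ} (ht : 0 ≤ t) (x v : X)
    (hM : ∀ s ∈ Ico 0 t, ‖exp (s • C) (C x) - v‖ ≤ M) :
    ‖exp (t • C) x - x - t • v‖ ≤ M * t := by
  have := norm_image_sub_le_of_norm_deriv_le_segment'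
    (f := fun s : ℝ => exp (s • C) x - s • v) (a := 0) (b := t) (C := M)
    (fun s _ => ((hasDerivAt_exp_smul_apply C x s).sub
      ((hasDerivAt_id s).smul_const v)).hasDerivWithinAt)
    (fun s hs => by simpa using hM s hs) t (right_mem_Icc.2 ht)
  simpa [sub_right_comm] using this

end BoundedDissipative

section MaximalDissipative

variable {X : Type*} [NormedAddCommGroup X] [InnerProductSpace ℂ X]

theorem re_inner_sub_nonpos_of_norm_le {x y : X} (h : ‖y‖ ≤ ‖x‖) :
    (inner ℂ x (y - x)).re ≤ 0 := by
  have hxx : (inner ℂ x x).re = ‖x‖ ^ 2 := inner_self_eq_norm_sq (𝕜 := ℂ) x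
  rw [inner_sub_right, Complex.sub_re, hxx, sub_nonpos]
  calc (inner ℂ x y).re ≤ ‖x‖ * ‖y‖ := (Complex.re_le_norm _).trans (norm_inner_le_norm x y)
    _ ≤ ‖x‖ ^ 2 := by rw [pow_two]; gcongr

/-- Dissipative operators in a complex Hilbert space; no density or closedness is assumed. -/
def IsDissipative (A : X →ₗ.[ℂ] X) : Prop :=
  ∀ x : A.domain, (inner ℂ (x : X) (A x)).re ≤ 0

theorem IsDissipative.mul_norm_le {A : X →ₗ.[ℂ] X} (hA : IsDissipative A) (r : ℝ) (x : A.domain) :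
    r * ‖(x : X)‖ ≤ ‖r • (x : X) - A x‖ := by
  rcases (norm_nonneg (x : X)).eq_or_lt with h0 | h0
  · rw [← h0, mul_zero]
    exact norm_nonneg _
  refine le_of_mul_le_mul_left ?_ h0
  have hxx : (inner ℂ (x : X) x).re = ‖(x : X)‖ ^ 2 := inner_self_eq_norm_sq (𝕜 := ℂ) (x : X)
  calc ‖(x : X)‖ * (r * ‖(x : X)‖) ≤ r * ‖(x : X)‖ ^ 2 - (inner ℂ (x : X) (A x)).re := by
        linarith [hA x]
    _ = (inner ℂ (x : X) (r • (x : X) - A x)).re := by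
        rw [inner_sub_right, inner_smul_right_eq_smul, Complex.sub_re, Complex.smul_re,
          smul_eq_mul, hxx]
    _ ≤ ‖(x : X)‖ * ‖r • (x : X) - A x‖ := (Complex.re_le_norm _).trans (norm_inner_le_norm _ _)

/-- Maximal dissipative operators, described by the range condition of the Lumer–Phillips
theorem. -/
structure IsMaximalDissipative (A : X →ₗ.[ℂ] X) : Prop where
  dissipative : IsDissipative A
  surjective : ∀ r : ℝ, 0 < r → Function.Surjective fun x : A.domain => r • (x : X) - A x

namespace IsMaximalDissipative

variable {A : X →ₗ.[ℂ] X} {r s : ℝ}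

theorem mem_graph_of_re_inner_nonpos (hA : IsMaximalDissipative A) {x y : X}
    (h : ∀ u : A.domain, (inner ℂ (x - u) (y - A u)).re ≤ 0) : (x, y) ∈ A.graph := by
  obtain ⟨u, hu⟩ := hA.surjective 1 one_pos (x - y)
  have hyx : y - A u = x - u := by
    simp only [one_smul, sub_eq_sub_iff_add_eq_add] at hu ⊢
    rw [add_comm, hu, add_comm]
  have hx : x - u = 0 := (re_inner_self_nonpos (𝕜 := ℂ)).1 (by simpa [hyx] using h u)
  rw [hx] at hyx
  rw [sub_eq_zero.1 hx, sub_eq_zero.1 hyx]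
  exact A.mem_graph u

theorem dense_domain [CompleteSpace X] (hA : IsMaximalDissipative A) :
    Dense (A.domain : Set X) := by
  rw [Submodule.dense_iff_topologicalClosure_eq_top, Submodule.topologicalClosure_eq_top_iff,
    Submodule.eq_bot_iff]
  intro w hw
  obtain ⟨x, rfl⟩ := hA.surjective 1 one_pos w
  have hinner : inner ℂ (x : X) x = inner ℂ (x : X) (A x) := by
    simpa [inner_sub_right, sub_eq_zero] using (Submodule.mem_orthogonal _ _).1 hw x x.2
  have hx : (x : X) = 0 :=
    (re_inner_self_nonpos (𝕜 := ℂ)).1 ((congrArg Complex.re hinner).trans_le (hA.dissipative x))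
  simp [Subtype.ext (a2 := (0 : A.domain)) hx]

theorem bijective (hA : IsMaximalDissipative A) (hr : 0 < r) :
    Function.Bijective (r • A.domain.subtype - A.toFun) := by
  refine ⟨(injective_iff_map_eq_zero _).2 fun x hx => ?_, hA.surjective r hr⟩
  have hx' : r • (x : X) - A x = 0 := hx
  have hle := hA.dissipative.mul_norm_le r x
  rw [hx', norm_zero] at hle
  exact Subtype.ext (norm_le_zero_iff.1 (nonpos_of_mul_nonpos_right hle hr))

/-- The resolvent `(r - A)⁻¹` at `r > 0`. -/
noncomputable def resolvent (hA : IsMaximalDissipative A) (hr : 0 < r) : X →L[ℂ] X :=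
  (A.domain.subtype ∘ₗ (LinearEquiv.ofBijective _ (hA.bijective hr)).symm.toLinearMap).mkContinuous
    r⁻¹ fun y => by
      rw [← div_eq_inv_mul, le_div_iff₀ hr, mul_comm]
      refine (hA.dissipative.mul_norm_le r _).trans_eq (congrArg _ ?_)
      exact (LinearEquiv.ofBijective _ (hA.bijective hr)).apply_symm_apply y

theorem exists_resolvent_eq (hA : IsMaximalDissipative A) (hr : 0 < r) (y : X) :
    ∃ x : A.domain, (x : X) = hA.resolvent hr y ∧ r • (x : X) - A x = y :=
  ⟨(LinearEquiv.ofBijective _ (hA.bijective hr)).symm y, rfl,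
    (LinearEquiv.ofBijective _ (hA.bijective hr)).apply_symm_apply y⟩

theorem resolvent_smul_sub (hA : IsMaximalDissipative A) (hr : 0 < r) (x : A.domain) :
    hA.resolvent hr (r • (x : X) - A x) = x :=
  congrArg Subtype.val ((LinearEquiv.ofBijective _ (hA.bijective hr)).symm_apply_apply x)

theorem one_mem_resolventSetPMap (hA : IsMaximalDissipative A) : 1 ∈ resolventSetPMap A := by
  refine ⟨hA.resolvent one_pos, fun y => ?_, fun x => ?_⟩
  · obtain ⟨x, hx, hy⟩ := hA.exists_resolvent_eq one_pos y
    rw [← hx]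
    exact ⟨x.2, by simpa using hy⟩
  · simpa using hA.resolvent_smul_sub one_pos x

theorem mul_norm_resolvent_le (hA : IsMaximalDissipative A) (hr : 0 < r) (y : X) :
    r * ‖hA.resolvent hr y‖ ≤ ‖y‖ := by
  obtain ⟨x, hx, rfl⟩ := hA.exists_resolvent_eq hr y
  rw [← hx]
  exact hA.dissipative.mul_norm_le r x

theorem sub_smul_resolvent_resolvent (hA : IsMaximalDissipative A) (hr : 0 < r) (hs : 0 < s)
    (y : X) : (s - r) • hA.resolvent hr (hA.resolvent hs y)
      = hA.resolvent hr y - hA.resolvent hs y := by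
  obtain ⟨x, hx, rfl⟩ := hA.exists_resolvent_eq hs y
  have hdecomp : (s - r) • (x : X) = (s • (x : X) - A x) - (r • (x : X) - A x) := by module
  rw [← hx, ← ContinuousLinearMap.map_smul_of_tower, hdecomp, map_sub, hA.resolvent_smul_sub hr]

theorem commute_resolvent (hA : IsMaximalDissipative A) (hr : 0 < r) (hs : 0 < s) :
    Commute (hA.resolvent hr) (hA.resolvent hs) := by
  rcases eq_or_ne r s with rfl | hrs
  · exact Commute.refl _
  ext y
  refine smul_right_injective X (sub_ne_zero.2 hrs.symm) ?_
  calc (s - r) • hA.resolvent hr (hA.resolvent hs y)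
      = -((r - s) • hA.resolvent hs (hA.resolvent hr y)) := by
        simp only [sub_smul_resolvent_resolvent, neg_sub]
    _ = (s - r) • hA.resolvent hs (hA.resolvent hr y) := by rw [← neg_smul, neg_sub]

theorem smul_resolvent_sub_self (hA : IsMaximalDissipative A) (hr : 0 < r) (x : A.domain) :
    r • hA.resolvent hr x - x = hA.resolvent hr (A x) := by
  have h := hA.resolvent_smul_sub hr x
  rw [map_sub, ContinuousLinearMap.map_smul_of_tower] at h
  rw [sub_eq_iff_eq_add, ← sub_eq_iff_eq_add', h]

theorem nnnorm_smul_resolvent_le (hA : IsMaximalDissipative A) (hr : 0 < r) :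
    ‖r • hA.resolvent hr‖₊ ≤ 1 :=
  ContinuousLinearMap.opNNNorm_le_bound _ _ fun y => by
    rw [one_mul, ← NNReal.coe_le_coe, coe_nnnorm, coe_nnnorm, smul_apply, norm_smul,
      Real.norm_of_nonneg hr.le]
    exact hA.mul_norm_resolvent_le hr y

/-- The Yosida approximation `r (r (r - A)⁻¹ - 1)` of `A`. -/
noncomputable def yosida (hA : IsMaximalDissipative A) (hr : 0 < r) : X →L[ℂ] X :=
  r • (r • hA.resolvent hr - 1)

theorem yosida_apply (hA : IsMaximalDissipative A) (hr : 0 < r) (x : A.domain) :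
    hA.yosida hr x = (r • hA.resolvent hr) (A x) := by
  simp only [yosida, smul_apply, sub_apply, one_apply_eq_self, smul_resolvent_sub_self]

theorem re_inner_yosida_nonpos (hA : IsMaximalDissipative A) (hr : 0 < r) (x : X) :
    (inner ℂ x (hA.yosida hr x)).re ≤ 0 := by
  simp only [yosida, smul_apply, sub_apply, one_apply_eq_self, inner_smul_right_eq_smul,
    Complex.smul_re, smul_eq_mul]
  refine mul_nonpos_of_nonneg_of_nonpos hr.le (re_inner_sub_nonpos_of_norm_le ?_)
  rw [norm_smul, Real.norm_of_nonneg hr.le]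
  exact hA.mul_norm_resolvent_le hr x

theorem commute_yosida (hA : IsMaximalDissipative A) (hr : 0 < r) (hs : 0 < s) :
    Commute (hA.yosida hr) (hA.yosida hs) :=
  ((((((hA.commute_resolvent hr hs).smul_left _).smul_right _).sub_left
    (Commute.one_left _)).sub_right (Commute.one_right _)).smul_left _).smul_right _

variable [CompleteSpace X]

theorem tendsto_smul_resolvent (hA : IsMaximalDissipative A) (y : X) :
    Tendsto (fun n : ℕ => (((n : ℝ) + 1) • hA.resolvent n.cast_add_one_pos) y) atTop (𝓝 y) := by
  refine tendsto_apply_of_dense (f := ContinuousLinearMap.id ℂ X)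
    (fun n => hA.nnnorm_smul_resolvent_le n.cast_add_one_pos) hA.dense_domain (fun x hx => ?_) y
  rw [tendsto_iff_norm_sub_tendsto_zero]
  have hzero : Tendsto (fun n : ℕ => ‖A ⟨x, hx⟩‖ * (1 / ((n : ℝ) + 1))) atTop (𝓝 0) := by
    simpa using tendsto_one_div_add_atTop_nhds_zero_nat.const_mul ‖A ⟨x, hx⟩‖
  refine squeeze_zero (fun n => norm_nonneg _) (fun n => ?_) hzero
  rw [smul_apply, ContinuousLinearMap.id_apply, hA.smul_resolvent_sub_self n.cast_add_one_pos
    ⟨x, hx⟩, mul_one_div, le_div_iff₀' n.cast_add_one_pos]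
  exact hA.mul_norm_resolvent_le n.cast_add_one_pos _

theorem tendsto_yosida (hA : IsMaximalDissipative A) (x : A.domain) :
    Tendsto (fun n : ℕ => hA.yosida n.cast_add_one_pos (x : X)) atTop (𝓝 (A x)) := by
  simpa only [yosida_apply] using hA.tendsto_smul_resolvent (A x)

end IsMaximalDissipative

end MaximalDissipative

theorem tendsto_of_tendsto_prod {ι κ E : Type*} [TopologicalSpace E] [RegularSpace E]
    {l : Filter ι} [l.NeBot] {m : Filter κ} {F : ι × κ → E} {f : κ → E} {y : E}
    (hF : Tendsto F (l ×ˢ m) (𝓝 y)) (hf : ∀ k, Tendsto (fun i => F (i, k)) l (𝓝 (f k))) :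
    Tendsto f m (𝓝 y) := by
  refine (closed_nhds_basis y).tendsto_right_iff.2 fun s hs => ?_
  obtain ⟨p, hp, q, hq, hpq⟩ := eventually_prod_iff.1 (hF.eventually_mem hs.1)
  filter_upwards [hq] with k hk
  exact hs.2.mem_of_tendsto (hf k) (hp.mono fun i hi => hpq hi hk)

section LumerPhillips

open NormedSpace

variable {X : Type*} [NormedAddCommGroup X] [InnerProductSpace ℂ X]
  {A : X →ₗ.[ℂ] X} {T : ℝ≥0 → X →L[ℂ] X}

theorem isC0Semigroup_of_contraction (zero : T 0 = 1) (add : ∀ s t, T (s + t) = T s * T t)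
    (contraction : ∀ t x, ‖T t x‖ ≤ ‖x‖) (cont : ∀ x, Tendsto (T · x) (𝓝 0) (𝓝 x)) :
    IsC0Semigroup T := by
  refine ⟨zero, add, fun x => continuous_iff_continuousAt.2 fun s => ?_⟩
  have hshift {s t : ℝ≥0} (hst : s ≤ t) : ‖T t x - T s x‖ ≤ ‖T (nndist t s) x - x‖ := by
    rw [NNReal.nndist_eq, tsub_eq_zero_of_le hst, max_eq_left zero_le]
    calc ‖T t x - T s x‖ = ‖T s (T (t - s) x - x)‖ := by
          rw [map_sub, ← mul_apply_eq_comp, ← add, add_tsub_cancel_of_le hst]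
      _ ≤ ‖T (t - s) x - x‖ := contraction s _
  have hle (t : ℝ≥0) : ‖T t x - T s x‖ ≤ ‖T (nndist t s) x - x‖ := by
    rcases le_total s t with hst | hts
    · exact hshift hst
    · rw [norm_sub_rev, nndist_comm]
      exact hshift hts
  have hdist : Tendsto (fun t => nndist t s) (𝓝 s) (𝓝 0) := by
    simpa using (continuous_id.nndist continuous_const).tendsto (x := s) (f := fun t => nndist t s)
  exact tendsto_iff_norm_sub_tendsto_zero.2 <| squeeze_zero (fun _ => norm_nonneg _) hle
    (tendsto_iff_norm_sub_tendsto_zero.1 ((cont x).comp hdist))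

theorem re_inner_nonpos_of_contraction (contraction : ∀ t x, ‖T t x‖ ≤ ‖x‖) {x y : X}
    (h : Tendsto (fun h : ℝ≥0 => ((h : ℂ)⁻¹) • (T h x - x)) (𝓝[>] 0) (𝓝 y)) :
    (inner ℂ x y).re ≤ 0 := by
  refine le_of_tendsto ((Complex.continuous_re.tendsto _).comp (tendsto_const_nhds.inner h))
    (Eventually.of_forall fun t => ?_)
  have hreal : ((t : ℂ)⁻¹) • (T t x - x) = ((t : ℝ)⁻¹) • (T t x - x) := by
    simp [RCLike.real_smul_eq_coe_smul (K := ℂ)]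
  rw [Function.comp_apply, hreal, inner_smul_right_eq_smul, Complex.smul_re]
  exact mul_nonpos_of_nonneg_of_nonpos (inv_nonneg.2 t.2)
    (re_inner_sub_nonpos_of_norm_le (contraction t x))

theorem norm_inv_smul_sub_le {h : ℝ≥0} (hh : 0 < h) {ε : ℝ} {u v : X}
    (H : ‖u - (h : ℝ) • v‖ ≤ ε * h) : ‖((h : ℂ)⁻¹) • u - v‖ ≤ ε := by
  have hh0 : (h : ℂ) ≠ 0 := by exact_mod_cast hh.ne'
  have hsplit : ((h : ℂ)⁻¹) • u - v = ((h : ℂ)⁻¹) • (u - (h : ℝ) • v) := by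
    rw [smul_sub, RCLike.real_smul_eq_coe_smul (K := ℂ) (h : ℝ) v]
    exact congrArg _ (inv_smul_smul₀ hh0 v).symm
  have hnorm : ‖((h : ℂ)⁻¹)‖ = (h : ℝ)⁻¹ := by simp
  rwa [hsplit, norm_smul, hnorm, inv_mul_le_iff₀ (NNReal.coe_pos.2 hh), mul_comm]

variable [CompleteSpace X] {C : ℕ → X →L[ℂ] X}

theorem exists_tendsto_exp (hC : ∀ n x, (inner ℂ x (C n x)).re ≤ 0)
    (hcomm : ∀ m n, Commute (C m) (C n)) (hd : Dense (A.domain : Set X))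
    (hlim : ∀ x : A.domain, Tendsto (C · x) atTop (𝓝 (A x))) :
    ∃ T : ℝ≥0 → X →L[ℂ] X, ∀ (t : ℝ≥0) x,
      Tendsto (fun n => exp ((t : ℝ) • C n) x) atTop (𝓝 (T t x)) := by
  have hcauchy (t : ℝ≥0) (x : X) : CauchySeq fun n => exp ((t : ℝ) • C n) x := by
    refine cauchySeq_apply_of_dense (fun n => nnnorm_exp_smul_le (hC n) t.2) hd (fun x hx => ?_) x
    have hprod := cauchySeq_iff_tendsto_dist_atTop_0.1 (hlim ⟨x, hx⟩).cauchySeq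
    refine cauchySeq_iff_tendsto_dist_atTop_0.2 <| squeeze_zero (fun _ => dist_nonneg)
      (fun p => ?_) (by simpa using hprod.const_mul (t : ℝ))
    rw [dist_eq_norm, dist_eq_norm]
    exact norm_exp_smul_apply_sub_le (hC p.1) (hC p.2) (hcomm _ _) t.coe_nonneg x
  choose f hf using fun t x => cauchySeq_tendsto_of_complete (hcauchy t x)
  exact ⟨fun t => continuousLinearMapOfTendsto _ (tendsto_pi_nhds.2 (hf t)), hf⟩

theorem tendsto_exp_smul_apply_prod (hC : ∀ n x, (inner ℂ x (C n x)).re ≤ 0)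
    (hd : Dense (A.domain : Set X)) (hlim : ∀ x : A.domain, Tendsto (C · x) atTop (𝓝 (A x)))
    (x : X) : Tendsto (fun p : ℕ × ℝ≥0 => exp ((p.2 : ℝ) • C p.1) x) (atTop ×ˢ 𝓝 0) (𝓝 x) := by
  refine tendsto_apply_of_dense (f := ContinuousLinearMap.id ℂ X)
    (fun p : ℕ × ℝ≥0 => nnnorm_exp_smul_le (hC p.1) p.2.2) hd (fun x hx => ?_) x
  have hbound : Tendsto (fun p : ℕ × ℝ≥0 => (p.2 : ℝ) * ‖C p.1 x‖) (atTop ×ˢ 𝓝 0) (𝓝 0) := by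
    have htime : Tendsto (fun p : ℕ × ℝ≥0 => (p.2 : ℝ)) (atTop ×ˢ 𝓝 0) (𝓝 0) :=
      NNReal.tendsto_coe.2 tendsto_snd
    simpa using htime.mul ((hlim ⟨x, hx⟩).norm.comp tendsto_fst)
  exact tendsto_iff_norm_sub_tendsto_zero.2 <| squeeze_zero (fun _ => norm_nonneg _)
    (fun p => norm_exp_smul_apply_sub_self_le (hC p.1) p.2.2 x) hbound

theorem norm_le_of_tendsto_exp (hC : ∀ n x, (inner ℂ x (C n x)).re ≤ 0)
    (hT : ∀ (t : ℝ≥0) x, Tendsto (fun n => exp ((t : ℝ) • C n) x) atTop (𝓝 (T t x)))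
    (t : ℝ≥0) (x : X) :
    ‖T t x‖ ≤ ‖x‖ :=
  le_of_tendsto (hT t x).norm
    (Eventually.of_forall fun n => norm_exp_smul_apply_le (hC n) t.2 x)

theorem isC0Semigroup_of_tendsto_exp (hC : ∀ n x, (inner ℂ x (C n x)).re ≤ 0)
    (hd : Dense (A.domain : Set X)) (hlim : ∀ x : A.domain, Tendsto (C · x) atTop (𝓝 (A x)))
    (hT : ∀ (t : ℝ≥0) x, Tendsto (fun n => exp ((t : ℝ) • C n) x) atTop (𝓝 (T t x))) :
    IsC0Semigroup T := by
  refine isC0Semigroup_of_contraction ?_ (fun s t => ?_) (norm_le_of_tendsto_exp hC hT)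
    fun x => tendsto_of_tendsto_prod (tendsto_exp_smul_apply_prod hC hd hlim x) (hT · x)
  · ext x
    exact tendsto_nhds_unique (hT 0 x) (by simp)
  · ext x
    refine tendsto_nhds_unique (hT (s + t) x) ?_
    simp only [NNReal.coe_add, exp_add_smul_apply]
    exact tendsto_apply_of_tendsto (fun n => nnnorm_exp_smul_le (hC n) s.2) (hT s (T t x)) (hT t x)

theorem tendsto_slope_exp_prod {x y : X}
    (h : Tendsto (fun p : ℕ × ℝ≥0 => exp ((p.2 : ℝ) • C p.1) (C p.1 x)) (atTop ×ˢ 𝓝 0) (𝓝 y)) :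
    Tendsto (fun p : ℕ × ℝ≥0 => ((p.2 : ℂ)⁻¹) • (exp ((p.2 : ℝ) • C p.1) x - x))
      (atTop ×ˢ 𝓝[>] 0) (𝓝 y) := by
  refine Metric.nhds_basis_closedBall.tendsto_right_iff.2 fun ε hε => ?_
  obtain ⟨p, hp, q, hq, hpq⟩ := eventually_prod_iff.1
    (h.eventually_mem (Metric.closedBall_mem_nhds _ hε))
  obtain ⟨δ, hδ, hball⟩ := Metric.eventually_nhds_iff.1 hq
  refine eventually_prod_iff.2 ⟨p, hp, fun t => 0 < t ∧ (t : ℝ) < δ, ?_, fun {n} hn {t} ht => ?_⟩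
  · refine eventually_mem_nhdsWithin.and (nhdsWithin_le_nhds ?_)
    exact (NNReal.continuous_coe.tendsto' 0 0 rfl).eventually_lt_const hδ
  refine mem_closedBall_iff_norm.2 (norm_inv_smul_sub_le ht.1
    (norm_exp_smul_apply_sub_sub_le (C n) t.coe_nonneg x y ?_))
  rintro s ⟨hs₀, hst⟩
  lift s to ℝ≥0 using hs₀
  have hsδ : dist s 0 < δ := by
    rw [NNReal.dist_eq, NNReal.coe_zero, sub_zero, abs_of_nonneg s.coe_nonneg]
    exact hst.trans ht.2
  exact mem_closedBall_iff_norm.1 (hpq hn (hball hsδ))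

theorem tendsto_slope_of_tendsto_exp (hC : ∀ n x, (inner ℂ x (C n x)).re ≤ 0)
    (hd : Dense (A.domain : Set X)) (hlim : ∀ x : A.domain, Tendsto (C · x) atTop (𝓝 (A x)))
    (hT : ∀ (t : ℝ≥0) x, Tendsto (fun n => exp ((t : ℝ) • C n) x) atTop (𝓝 (T t x)))
    (x : A.domain) :
    Tendsto (fun h : ℝ≥0 => ((h : ℂ)⁻¹) • (T h x - x)) (𝓝[>] 0) (𝓝 (A x)) :=
  tendsto_of_tendsto_prod
    (tendsto_slope_exp_prod (tendsto_apply_of_tendsto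
      (F := fun p : ℕ × ℝ≥0 => exp ((p.2 : ℝ) • C p.1))
      (fun p => nnnorm_exp_smul_le (hC p.1) p.2.2)
      (tendsto_exp_smul_apply_prod hC hd hlim (A x)) ((hlim x).comp tendsto_fst)))
    fun h => ((hT h x).sub_const _).const_smul _

theorem IsMaximalDissipative.generatesC0Semigroup (hA : IsMaximalDissipative A) :
    GeneratesC0Semigroup A := by
  have hC (n : ℕ) := hA.re_inner_yosida_nonpos n.cast_add_one_pos
  obtain ⟨T, hT⟩ := exists_tendsto_exp hC (fun m n => hA.commute_yosida _ _) hA.dense_domain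
    hA.tendsto_yosida
  have hslope := tendsto_slope_of_tendsto_exp hC hA.dense_domain hA.tendsto_yosida hT
  refine ⟨T, isC0Semigroup_of_tendsto_exp hC hA.dense_domain hA.tendsto_yosida hT,
    fun x y => ⟨fun hxy => ?_, fun hxy => hA.mem_graph_of_re_inner_nonpos fun u => ?_⟩⟩
  · obtain ⟨u, rfl, rfl⟩ := (LinearPMap.mem_graph_iff _).1 hxy
    exact hslope u
  · refine re_inner_nonpos_of_contraction (norm_le_of_tendsto_exp hC hT) ?_
    simpa only [← smul_sub, sub_sub_sub_comm, map_sub] using hxy.sub (hslope u)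

end LumerPhillips

section ClosedDissipative

variable {X : Type*} [NormedAddCommGroup X] [InnerProductSpace ℂ X] [CompleteSpace X]
  {A : X →ₗ.[ℂ] X}

theorem IsDissipative.isClosed_range (hA : IsDissipative A) (hc : A.IsClosed) {r : ℝ}
    (hr : 0 < r) : IsClosed (LinearMap.range (r • A.domain.subtype - A.toFun) : Set X) := by
  refine isClosed_of_closure_subset fun y hy => ?_
  obtain ⟨s, hs, hlim⟩ := mem_closure_iff_seq_limit.1 hy
  choose x hx using hs
  have hx' : ∀ n, r • (x n : X) - A (x n) = s n := hx
  have hdist : ∀ m n, dist (x m : X) (x n) ≤ r⁻¹ * dist (s m) (s n) := fun m n => by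
    rw [dist_eq_norm, dist_eq_norm, ← div_eq_inv_mul, le_div_iff₀ hr, mul_comm]
    refine (hA.mul_norm_le r (x m - x n)).trans_eq (congrArg _ ?_)
    rw [A.map_sub, ← hx', ← hx', Submodule.coe_sub]
    module
  have hcauchy : CauchySeq fun n => (x n : X) := by
    refine Metric.cauchySeq_iff.2 fun ε hε => ?_
    obtain ⟨N, hN⟩ := Metric.cauchySeq_iff.1 hlim.cauchySeq (r * ε) (by positivity)
    refine ⟨N, fun m hm n hn => (hdist m n).trans_lt ?_⟩
    rw [inv_mul_lt_iff₀ hr]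
    exact hN m hm n hn
  obtain ⟨x₀, hx₀⟩ := cauchySeq_tendsto_of_complete hcauchy
  have hAx : Tendsto (fun n => A (x n)) atTop (𝓝 (r • x₀ - y)) :=
    ((hx₀.const_smul r).sub hlim).congr fun n => by rw [← hx', sub_sub_cancel]
  obtain ⟨u, hu, hAu⟩ := (LinearPMap.mem_graph_iff _).1
    (hc.mem_of_tendsto (hx₀.prodMk_nhds hAx) (Eventually.of_forall fun n => A.mem_graph (x n)))
  exact ⟨u, show r • (u : X) - A u = y by rw [hu, hAu, sub_sub_cancel]⟩

theorem IsDissipative.isMaximalDissipative (hA : IsDissipative A) (hc : A.IsClosed)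
    (horth : ∀ (r : ℝ) (w : X), 0 < r →
      (∀ x : A.domain, inner ℂ (r • (x : X) - A x) w = 0) → w = 0) :
    IsMaximalDissipative A := by
  refine ⟨hA, fun r hr =>
    LinearMap.range_eq_top (f := r • A.domain.subtype - A.toFun) |>.1 ?_⟩
  rw [← (hA.isClosed_range hc hr).submodule_topologicalClosure_eq,
    Submodule.topologicalClosure_eq_top_iff, Submodule.eq_bot_iff]
  exact fun w hw => horth r w hr fun x => (Submodule.mem_orthogonal _ _).1 hw _ ⟨x, rfl⟩

end ClosedDissipative

section SkewBoundaryTriple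

variable {H U : Type*} [NormedAddCommGroup H] [InnerProductSpace ℂ H]
  [NormedAddCommGroup U] [InnerProductSpace ℂ U]

/-- A boundary triple `(U, a, b)` for the adjoint of a skew-symmetric operator. By `green` and
`maximal`, `L` is the negative adjoint of its restriction to `ker a ∩ ker b`. The boundary form is
that of an impedance energy balance. -/
structure IsSkewBoundaryTriple (L : H →ₗ.[ℂ] H) (a b : L.domain →ₗ[ℂ] U) : Prop where
  green : ∀ z w : L.domain, inner ℂ (L z) (w : H) + inner ℂ (z : H) (L w)
    = inner ℂ (a z) (b w) + inner ℂ (b z) (a w)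
  surjective : ∀ u v : U, ∃ z, a z = u ∧ b z = v
  maximal : ∀ w v : H, (∀ z : L.domain, a z = 0 → b z = 0 →
    inner ℂ (L z) w = -inner ℂ (z : H) v) → (w, v) ∈ L.graph

namespace IsSkewBoundaryTriple

variable {L : H →ₗ.[ℂ] H} {a b : L.domain →ₗ[ℂ] U}

theorem two_mul_green (h : IsSkewBoundaryTriple L a b) (z w : L.domain) :
    2 * (inner ℂ (L z) (w : H) + inner ℂ (z : H) (L w))
      = inner ℂ (a z + b z) (a w + b w) - inner ℂ (a z - b z) (a w - b w) := by
  rw [h.green]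
  simp only [inner_add_left, inner_add_right, inner_sub_left, inner_sub_right]
  ring

theorem four_mul_re_inner (h : IsSkewBoundaryTriple L a b) (z : L.domain) :
    4 * (inner ℂ (z : H) (L z)).re = ‖a z + b z‖ ^ 2 - ‖a z - b z‖ ^ 2 := by
  have hre := congrArg Complex.re (h.two_mul_green z z)
  have hsymm : (inner ℂ (L z) (z : H)).re = (inner ℂ (z : H) (L z)).re := inner_re_symm (𝕜 := ℂ) _ _
  have hadd : (inner ℂ (a z + b z) (a z + b z)).re = ‖a z + b z‖ ^ 2 :=
    inner_self_eq_norm_sq (𝕜 := ℂ) _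
  have hsub : (inner ℂ (a z - b z) (a z - b z)).re = ‖a z - b z‖ ^ 2 :=
    inner_self_eq_norm_sq (𝕜 := ℂ) _
  rw [Complex.mul_re, Complex.re_ofNat, Complex.im_ofNat, zero_mul, sub_zero, Complex.add_re,
    Complex.sub_re, hsymm, hadd, hsub] at hre
  linarith

theorem mem_graph_iff (h : IsSkewBoundaryTriple L a b) {w v : H} :
    (w, v) ∈ L.graph ↔
      ∀ z : L.domain, a z = 0 → b z = 0 → inner ℂ (L z) w = -inner ℂ (z : H) v := by
  refine ⟨fun hwv z ha hb => ?_, h.maximal w v⟩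
  obtain ⟨u, rfl, rfl⟩ := (LinearPMap.mem_graph_iff _).1 hwv
  rw [eq_neg_iff_add_eq_zero, h.green, ha, hb, inner_zero_left, inner_zero_left, add_zero]

theorem isClosed (h : IsSkewBoundaryTriple L a b) : L.IsClosed := by
  have hgraph : (L.graph : Set (H × H)) = ⋂ (z : L.domain) (_ : a z = 0) (_ : b z = 0),
      {p | inner ℂ (L z) p.1 = -inner ℂ (z : H) p.2} := by
    ext ⟨w, v⟩
    simp only [SetLike.mem_coe, h.mem_graph_iff, mem_iInter, mem_ofPred_eq]
  rw [LinearPMap.IsClosed, hgraph]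
  exact isClosed_iInter fun z => isClosed_iInter fun _ => isClosed_iInter fun _ =>
    isClosed_eq (by fun_prop) (by fun_prop)

theorem eq_zero_of_inner_add_inner_eq_zero (h : IsSkewBoundaryTriple L a b) {α β : U}
    (hαβ : ∀ w, inner ℂ α (b w) + inner ℂ β (a w) = 0) : α = 0 ∧ β = 0 := by
  constructor
  · obtain ⟨w, ha, hb⟩ := h.surjective 0 α
    simpa [ha, hb] using hαβ w
  · obtain ⟨w, ha, hb⟩ := h.surjective β 0
    simpa [ha, hb] using hαβ w

theorem eq_of_tendsto (h : IsSkewBoundaryTriple L a b) {ι : Type*} {l : Filter ι} [l.NeBot]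
    {z : ι → L.domain} {z₀ : L.domain} {α β : U} (hz : Tendsto (fun i => (z i : H)) l (𝓝 z₀))
    (hLz : Tendsto (fun i => L (z i)) l (𝓝 (L z₀))) (ha : Tendsto (fun i => a (z i)) l (𝓝 α))
    (hb : Tendsto (fun i => b (z i)) l (𝓝 β)) : α = a z₀ ∧ β = b z₀ := by
  have hαβ : α - a z₀ = 0 ∧ β - b z₀ = 0 := by
    refine h.eq_zero_of_inner_add_inner_eq_zero fun w => ?_
    have hbdry := (ha.inner (𝕜 := ℂ) (tendsto_const_nhds (x := b w))).add
      (hb.inner (𝕜 := ℂ) (tendsto_const_nhds (x := a w)))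
    have hgreen := (hLz.inner (𝕜 := ℂ) (tendsto_const_nhds (x := (w : H)))).add
      (hz.inner (𝕜 := ℂ) (tendsto_const_nhds (x := L w)))
    simp only [h.green] at hgreen
    rw [inner_sub_left, inner_sub_left, sub_add_sub_comm, tendsto_nhds_unique hbdry hgreen,
      sub_self]
  exact hαβ.imp sub_eq_zero.1 sub_eq_zero.1

theorem tendsto_boundary [CompleteSpace H] [CompleteSpace U] (h : IsSkewBoundaryTriple L a b)
    {ι : Type*} {l : Filter ι} {z : ι → L.domain} {z₀ : L.domain}
    (hz : Tendsto (fun i => (z i : H)) l (𝓝 z₀)) (hLz : Tendsto (fun i => L (z i)) l (𝓝 (L z₀))) :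
    Tendsto (fun i => a (z i)) l (𝓝 (a z₀)) ∧ Tendsto (fun i => b (z i)) l (𝓝 (b z₀)) := by
  let e : L.graph →ₗ[ℂ] L.domain :=
    ((LinearMap.fst ℂ H H).comp L.graph.subtype).codRestrict L.domain
      fun p => LinearPMap.mem_domain_of_mem_graph p.2
  have hLe : ∀ p, L (e p) = (p : H × H).2 := fun p =>
    (LinearPMap.mem_graph_snd_inj' L p.2 (L.mem_graph (e p)) rfl).symm
  have := h.isClosed.completeSpace_coe
  have hcont : Continuous ((a.prod b).comp e) := by
    refine LinearMap.continuous_of_seq_closed_graph _ ?_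
    rintro p q ⟨α, β⟩ hp hab
    have hp' := (continuous_subtype_val.tendsto q).comp hp
    obtain ⟨hα, hβ⟩ := h.eq_of_tendsto (z := e ∘ p) (z₀ := e q) hp'.fst_nhds
      (by simpa only [Function.comp_apply, hLe] using hp'.snd_nhds) hab.fst_nhds hab.snd_nhds
    exact Prod.ext hα hβ
  let toGraph : L.domain → L.graph := fun u => ⟨(u, L u), L.mem_graph u⟩
  have hgraph : Tendsto (fun i => toGraph (z i)) l (𝓝 (toGraph z₀)) :=
    tendsto_subtype_rng.2 (hz.prodMk_nhds hLz)
  have hlim : Tendsto (fun i => (a (z i), b (z i))) l (𝓝 (a z₀, b z₀)) :=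
    (hcont.tendsto (toGraph z₀)).comp hgraph
  exact ⟨hlim.fst_nhds, hlim.snd_nhds⟩

end IsSkewBoundaryTriple

end SkewBoundaryTriple

/-- The colligation with interior operator `L`, input map `G` and output map `K`. -/
def boundaryColligation {H U W : Type*} [NormedAddCommGroup H] [InnerProductSpace ℂ H]
    [CompleteSpace H] [NormedAddCommGroup U] [InnerProductSpace ℂ U] [CompleteSpace U]
    [NormedAddCommGroup W] [InnerProductSpace ℂ W] [CompleteSpace W]
    (L : H →ₗ.[ℂ] H) (G : L.domain →ₗ[ℂ] U) (K : L.domain →ₗ[ℂ] W) : Colligation U H W :=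
  ⟨L.domain, G, L.toFun, K⟩

namespace Colligation

variable {U X Y : Type*}
  [NormedAddCommGroup U] [InnerProductSpace ℂ U] [CompleteSpace U]
  [NormedAddCommGroup X] [InnerProductSpace ℂ X] [CompleteSpace X]
  [NormedAddCommGroup Y] [InnerProductSpace ℂ Y] [CompleteSpace Y]

theorem mem_graph_mainOp {Θ : Colligation U X Y} {x y : X} :
    (x, y) ∈ Θ.mainOp.graph ↔ ∃ z : Θ.dom, Θ.G z = 0 ∧ z = x ∧ Θ.L z = y := by
  rw [LinearPMap.mem_graph_iff]
  constructor
  · rintro ⟨⟨_, ⟨z, hz, rfl⟩, hzdom⟩, rfl, rfl⟩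
    exact ⟨z, hz, rfl, rfl⟩
  · rintro ⟨z, hz, rfl, rfl⟩
    exact ⟨⟨z, ⟨z, hz, rfl⟩, z.2⟩, rfl, rfl⟩

theorem exists_eq_mainOp {Θ : Colligation U X Y} (x : Θ.mainOp.domain) :
    ∃ z : Θ.dom, Θ.G z = 0 ∧ z = (x : X) ∧ Θ.L z = Θ.mainOp x :=
  mem_graph_mainOp.1 (Θ.mainOp.mem_graph x)

end Colligation

namespace IsSkewBoundaryTriple

section MainOp

variable {H U W : Type*} [NormedAddCommGroup H] [InnerProductSpace ℂ H] [CompleteSpace H]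
  [NormedAddCommGroup U] [InnerProductSpace ℂ U] [CompleteSpace U]
  [NormedAddCommGroup W] [InnerProductSpace ℂ W] [CompleteSpace W]
  {L : H →ₗ.[ℂ] H} {a b G : L.domain →ₗ[ℂ] U} {K : L.domain →ₗ[ℂ] W} {P : U →L[ℂ] U}

theorem isClosed_combined (h : IsSkewBoundaryTriple L a b) {g : U × U → U} {k : U × U → W}
    (hg : Continuous g) (hk : Continuous k) (hG : ∀ z, G z = g (a z, b z))
    (hK : ∀ z, K z = k (a z, b z)) : (boundaryColligation L G K).combined.IsClosed := by
  refine IsSeqClosed.isClosed ?_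
  rintro s ⟨x, u, y, w⟩ hs hlim
  have hexists : ∀ n, ∃ z : L.domain, ((z : H), G z, L z, K z) = s n := fun n => by
    obtain ⟨z, hz, hGLK⟩ := (LinearPMap.mem_graph_iff _).1 (hs n)
    exact ⟨z, Prod.ext hz hGLK⟩
  choose z hz using hexists
  rw [← funext hz] at hlim
  have hx : Tendsto (fun n => (z n : H)) atTop (𝓝 x) := hlim.fst_nhds
  have hu : Tendsto (fun n => G (z n)) atTop (𝓝 u) := hlim.snd_nhds.fst_nhds
  have hy : Tendsto (fun n => L (z n)) atTop (𝓝 y) := hlim.snd_nhds.snd_nhds.fst_nhds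
  have hw : Tendsto (fun n => K (z n)) atTop (𝓝 w) := hlim.snd_nhds.snd_nhds.snd_nhds
  obtain ⟨z₀, rfl, rfl⟩ := (LinearPMap.mem_graph_iff _).1 (h.isClosed.mem_of_tendsto
    (hx.prodMk_nhds hy) (Eventually.of_forall fun n => L.mem_graph (z n)))
  obtain ⟨ha, hb⟩ := h.tendsto_boundary hx hy
  have hGz : G z₀ = u := by
    simp only [hG] at hu ⊢
    exact tendsto_nhds_unique ((hg.tendsto _).comp (ha.prodMk_nhds hb)) hu
  have hKz : K z₀ = w := by
    simp only [hK] at hw ⊢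
    exact tendsto_nhds_unique ((hk.tendsto _).comp (ha.prodMk_nhds hb)) hw
  exact (LinearPMap.mem_graph_iff _).2 ⟨z₀, rfl, Prod.ext hGz (Prod.ext rfl hKz)⟩

theorem isClosed_mainOp (h : IsSkewBoundaryTriple L a b)
    (hG : ∀ z, G z = 0 ↔ a z + b z = P (a z - b z)) :
    (boundaryColligation L G K).mainOp.IsClosed := by
  refine IsSeqClosed.isClosed ?_
  rintro s ⟨x, y⟩ hs hlim
  have hexists : ∀ n, ∃ z : L.domain, G z = 0 ∧ ((z : H), L z) = s n := fun n => by
    obtain ⟨z, hGz, hz, hLz⟩ := Colligation.mem_graph_mainOp.1 (hs n)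
    exact ⟨z, hGz, Prod.ext hz hLz⟩
  choose z hGz hz using hexists
  rw [← funext hz] at hlim
  have hx : Tendsto (fun n => (z n : H)) atTop (𝓝 x) := hlim.fst_nhds
  have hy : Tendsto (fun n => L (z n)) atTop (𝓝 y) := hlim.snd_nhds
  obtain ⟨z₀, rfl, rfl⟩ := (LinearPMap.mem_graph_iff _).1 (h.isClosed.mem_of_tendsto hlim
    (Eventually.of_forall fun n => L.mem_graph (z n)))
  obtain ⟨ha, hb⟩ := h.tendsto_boundary hx hy
  have hadd : Tendsto (fun n => a (z n) + b (z n)) atTop (𝓝 (P (a z₀ - b z₀))) := by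
    simp only [(hG _).1 (hGz _)]
    exact (P.continuous.tendsto _).comp (ha.sub hb)
  exact Colligation.mem_graph_mainOp.2
    ⟨z₀, (hG z₀).2 (tendsto_nhds_unique (ha.add hb) hadd), rfl, rfl⟩

theorem isDissipative_mainOp (h : IsSkewBoundaryTriple L a b) (hP : ‖P‖ ≤ 1)
    (hG : ∀ z, G z = 0 → a z + b z = P (a z - b z)) :
    IsDissipative (boundaryColligation L G K).mainOp := by
  intro x
  obtain ⟨z, hGz, hz, hLz⟩ := Colligation.exists_eq_mainOp x
  have hle : ‖a z + b z‖ ≤ ‖a z - b z‖ := by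
    rw [hG z hGz]
    exact (P.le_of_opNorm_le hP _).trans_eq (one_mul _)
  have hsq := pow_le_pow_left₀ (norm_nonneg _) hle 2
  have henergy := h.four_mul_re_inner z
  rw [← hz, ← hLz]
  change (inner ℂ (z : H) (L z)).re ≤ 0
  linarith

end MainOp

section MaximalDissipative

variable {H U : Type*} [NormedAddCommGroup H] [InnerProductSpace ℂ H]
  [NormedAddCommGroup U] [InnerProductSpace ℂ U]
  {L : H →ₗ.[ℂ] H} {a b : L.domain →ₗ[ℂ] U} {P : U →L[ℂ] U}

theorem norm_sub_le_norm_add (h : IsSkewBoundaryTriple L a b) (hP : ‖P‖ ≤ 1) {w : L.domain}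
    (hw : ∀ z, a z + b z = P (a z - b z) → inner ℂ (L z) (w : H) + inner ℂ (z : H) (L w) = 0) :
    ‖a w - b w‖ ≤ ‖a w + b w‖ := by
  set c := a w - b w
  obtain ⟨z, ha, hb⟩ := h.surjective ((2⁻¹ : ℂ) • (P c + c)) ((2⁻¹ : ℂ) • (P c - c))
  have hsub : a z - b z = c := by rw [ha, hb]; module
  have hadd : a z + b z = P c := by rw [ha, hb]; module
  have hinner : inner ℂ (P c) (a w + b w) = inner ℂ c c := by
    have hgreen := h.two_mul_green z w
    rwa [hw z (by rw [hadd, hsub]), mul_zero, hadd, hsub, eq_comm, sub_eq_zero] at hgreen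
  rcases (norm_nonneg c).eq_or_lt with hc | hc
  · exact hc.symm.trans_le (norm_nonneg _)
  refine le_of_mul_le_mul_left ?_ hc
  calc ‖c‖ * ‖c‖ = ‖inner ℂ (P c) (a w + b w)‖ := by
        rw [hinner, ← inner_self_re_eq_norm, inner_self_eq_norm_mul_norm]
    _ ≤ ‖P c‖ * ‖a w + b w‖ := norm_inner_le_norm _ _
    _ ≤ ‖c‖ * ‖a w + b w‖ := by
        gcongr
        exact (P.le_of_opNorm_le hP c).trans_eq (one_mul _)

theorem eq_zero_of_orthogonal (h : IsSkewBoundaryTriple L a b) (hP : ‖P‖ ≤ 1) {r : ℝ} (hr : 0 < r)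
    {w : H} (hw : ∀ z : L.domain, a z + b z = P (a z - b z) → inner ℂ (r • (z : H) - L z) w = 0) :
    w = 0 := by
  have hL : ∀ z : L.domain, a z + b z = P (a z - b z) →
      inner ℂ (L z) w = -inner ℂ (z : H) (-(r • w)) := fun z hz => by
    have := hw z hz
    rw [inner_sub_left, sub_eq_zero] at this
    rw [← this, inner_neg_right, neg_neg, inner_smul_left_eq_smul, inner_smul_right_eq_smul]
  obtain ⟨u, rfl, hLu⟩ := (LinearPMap.mem_graph_iff _).1
    (h.maximal w (-(r • w)) fun z ha hb => hL z (by rw [ha, hb, add_zero, sub_zero, map_zero]))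
  have hle : ‖a u - b u‖ ≤ ‖a u + b u‖ := h.norm_sub_le_norm_add hP fun z hz => by
    rw [hL z hz, hLu, neg_add_cancel]
  have hsq := pow_le_pow_left₀ (norm_nonneg _) hle 2
  have henergy := h.four_mul_re_inner u
  have huu : (inner ℂ (u : H) u).re = ‖(u : H)‖ ^ 2 := inner_self_eq_norm_sq (𝕜 := ℂ) (u : H)
  rw [hLu, inner_neg_right, inner_smul_right_eq_smul, Complex.neg_re, Complex.smul_re, huu,
    smul_eq_mul] at henergy
  have hnorm : ‖(u : H)‖ ^ 2 ≤ 0 := by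
    refine nonpos_of_mul_nonpos_right ?_ hr
    linarith
  exact norm_eq_zero.1 (pow_eq_zero_iff two_ne_zero |>.1 (hnorm.antisymm (sq_nonneg _)))

end MaximalDissipative

section WellPosed

variable {H U W : Type*} [NormedAddCommGroup H] [InnerProductSpace ℂ H] [CompleteSpace H]
  [NormedAddCommGroup U] [InnerProductSpace ℂ U] [CompleteSpace U]
  [NormedAddCommGroup W] [InnerProductSpace ℂ W] [CompleteSpace W]
  {L : H →ₗ.[ℂ] H} {a b G : L.domain →ₗ[ℂ] U} {K : L.domain →ₗ[ℂ] W} {P : U →L[ℂ] U}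

theorem isMaximalDissipative_mainOp (h : IsSkewBoundaryTriple L a b) (hP : ‖P‖ ≤ 1)
    (hG : ∀ z, G z = 0 ↔ a z + b z = P (a z - b z)) :
    IsMaximalDissipative (boundaryColligation L G K).mainOp := by
  refine (h.isDissipative_mainOp hP fun z => (hG z).1).isMaximalDissipative (h.isClosed_mainOp hG)
    fun r w hr hw => h.eq_zero_of_orthogonal hP hr fun z hz => ?_
  have hgraph : ((z : H), L z) ∈ (boundaryColligation L G K).mainOp.graph :=
    Colligation.mem_graph_mainOp.2 ⟨z, (hG z).2 hz, rfl, rfl⟩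
  obtain ⟨x, hx : (x : H) = z, hLx : _ = L z⟩ := (LinearPMap.mem_graph_iff _).1 hgraph
  rw [← hx, ← hLx]
  exact hw x

theorem isInternallyWellPosed (h : IsSkewBoundaryTriple L a b) (hP : ‖P‖ ≤ 1) {c : ℂ} (hc : c ≠ 0)
    (hG : ∀ z, G z = c • (a z + b z - P (a z - b z))) {k : U × U → W} (hk : Continuous k)
    (hK : ∀ z, K z = k (a z, b z)) : (boundaryColligation L G K).IsInternallyWellPosed := by
  have hmax : IsMaximalDissipative (boundaryColligation L G K).mainOp :=
    h.isMaximalDissipative_mainOp hP fun z => by rw [hG, smul_eq_zero_iff_right hc, sub_eq_zero]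
  refine ⟨⟨h.isClosed_combined (g := fun p => c • (p.1 + p.2 - P (p.1 - p.2))) (by fun_prop) hk
    hG hK, fun w => ?_, ?_, 1, hmax.one_mem_resolventSetPMap⟩, hmax.generatesC0Semigroup⟩
  · obtain ⟨z, ha, hb⟩ := h.surjective ((2 * c)⁻¹ • w) ((2 * c)⁻¹ • w)
    refine ⟨z, (hG z).trans ?_⟩
    rw [ha, hb, sub_self, map_zero, sub_zero, ← two_smul ℂ, smul_smul, smul_smul,
      mul_comm c 2, mul_inv_cancel₀ (mul_ne_zero two_ne_zero hc), one_smul]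
  · exact hmax.dense_domain.mono fun x hx => hx.1

theorem dense_domain (h : IsSkewBoundaryTriple L a b) : Dense (L.domain : Set H) :=
  (h.isMaximalDissipative_mainOp (G := a + b) (K := a) (P := 0)
    (norm_zero.trans_le zero_le_one) fun _ => Iff.rfl).dense_domain.mono fun _ hx => hx.2

end WellPosed

end IsSkewBoundaryTriple

namespace Colligation

section EnergyBalance

variable {U X Y : Type*}
  [NormedAddCommGroup U] [InnerProductSpace ℂ U] [CompleteSpace U]
  [NormedAddCommGroup X] [InnerProductSpace ℂ X] [CompleteSpace X]
  [NormedAddCommGroup Y] [InnerProductSpace ℂ Y] [CompleteSpace Y]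
  {Θ : Colligation U X Y}

theorem IsSmoothSolution.derivWithin_norm_sq {u : ℝ → U} {z : ℝ → Θ.dom} {y : ℝ → Y}
    (h : Θ.IsSmoothSolution u z y) {t : ℝ} (ht : t ∈ Ici (0 : ℝ)) :
    derivWithin (fun s => ‖(z s : X)‖ ^ 2) (Ici 0) t
      = 2 * (inner ℂ (z t : X) (Θ.L (z t))).re := by
  let _ : InnerProductSpace ℝ X := InnerProductSpace.rclikeToReal ℂ X
  exact (h.state_eq t ht).norm_sq.derivWithin (uniqueDiffOn_Ici 0 t ht)

theorem IsInternallyWellPosed.isScatteringPassive (h : Θ.IsInternallyWellPosed)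
    (hΘ : ∀ z : Θ.dom, 2 * (inner ℂ (z : X) (Θ.L z)).re + ‖Θ.K z‖ ^ 2 ≤ ‖Θ.G z‖ ^ 2) :
    Θ.IsScatteringPassive :=
  ⟨h, fun u z y hs t ht => by
    rw [hs.derivWithin_norm_sq ht, hs.input_eq t ht, hs.output_eq t ht]
    exact hΘ (z t)⟩

theorem IsInternallyWellPosed.isScatteringEnergyPreserving (h : Θ.IsInternallyWellPosed)
    (hΘ : ∀ z : Θ.dom, 2 * (inner ℂ (z : X) (Θ.L z)).re + ‖Θ.K z‖ ^ 2 = ‖Θ.G z‖ ^ 2) :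
    Θ.IsScatteringEnergyPreserving :=
  ⟨h, fun u z y hs t ht => by
    rw [hs.derivWithin_norm_sq ht, hs.input_eq t ht, hs.output_eq t ht]
    exact hΘ (z t)⟩

end EnergyBalance

section Cayley

variable {U X : Type*}
  [NormedAddCommGroup U] [InnerProductSpace ℂ U] [CompleteSpace U]
  [NormedAddCommGroup X] [InnerProductSpace ℂ X] [CompleteSpace X]

theorem cayley_one (Θ : Colligation U X U) :
    Θ.cayley 1 = ⟨Θ.dom, (Real.sqrt 2 : ℂ)⁻¹ • (Θ.G + Θ.K), Θ.L,
      (Real.sqrt 2 : ℂ)⁻¹ • (Θ.G - Θ.K)⟩ := by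
  simp only [cayley, Complex.one_re, mul_one, map_one, one_smul]

theorem inv_sqrt_two_mul_inv_sqrt_two : (Real.sqrt 2 : ℂ)⁻¹ * (Real.sqrt 2 : ℂ)⁻¹ = 2⁻¹ := by
  rw [← mul_inv, ← Complex.ofReal_mul, Real.mul_self_sqrt zero_le_two, Complex.ofReal_ofNat]

theorem cayley_one_cayley_one (Θ : Colligation U X U) : (Θ.cayley 1).cayley 1 = Θ := by
  obtain ⟨dom, G, L, K⟩ := Θ
  simp only [cayley_one, ← smul_add, ← smul_sub, smul_smul, inv_sqrt_two_mul_inv_sqrt_two]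
  congr 1 <;> module

theorem IsScatteringPassive.isImpedancePassive_cayley_one {Θ : Colligation U X U}
    (h : Θ.IsScatteringPassive) : (Θ.cayley 1).IsImpedancePassive :=
  ⟨1, one_pos, by rwa [cayley_one_cayley_one]⟩

theorem IsScatteringEnergyPreserving.isImpedanceEnergyPreserving_cayley_one
    {Θ : Colligation U X U} (h : Θ.IsScatteringEnergyPreserving) :
    (Θ.cayley 1).IsImpedanceEnergyPreserving :=
  ⟨1, one_pos, by rwa [cayley_one_cayley_one]⟩

end Cayley

end Colligation

section Nodes

variable {H U : Type*} [NormedAddCommGroup H] [InnerProductSpace ℂ H] [CompleteSpace H]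
  [NormedAddCommGroup U] [InnerProductSpace ℂ U] [CompleteSpace U]
  {L : H →ₗ.[ℂ] H} {a b : L.domain →ₗ[ℂ] U} {P : U →L[ℂ] U}

/-- The node of a boundary triple with incoming wave `(a + b) / √2` as input and the outgoing wave
`(b - a) / √2`, transformed by `P`, as output. -/
noncomputable def scatteringColligation (L : H →ₗ.[ℂ] H) (a b : L.domain →ₗ[ℂ] U) (P : U →L[ℂ] U) :
    Colligation U H U :=
  boundaryColligation L ((Real.sqrt 2 : ℂ)⁻¹ • (a + b))
    ((-(Real.sqrt 2 : ℂ)⁻¹) • (P.toLinearMap ∘ₗ (a - b)))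

/-- The node of a boundary triple whose input is `((1 - P) a + (1 + P) b) / 2`, so that zero input
is the Robin-type condition `a + b = P (a - b)`. -/
noncomputable def robinColligation (L : H →ₗ.[ℂ] H) (a b : L.domain →ₗ[ℂ] U) (P : U →L[ℂ] U) :
    Colligation U H U :=
  boundaryColligation L
    ((2⁻¹ : ℂ) • ((1 - P).toLinearMap ∘ₗ a + (1 + P).toLinearMap ∘ₗ b))
    ((2⁻¹ : ℂ) • ((1 + P).toLinearMap ∘ₗ a + (1 - P).toLinearMap ∘ₗ b))

theorem scatteringColligation_cayley_one :
    (scatteringColligation L a b P).cayley 1 = robinColligation L a b P := by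
  have hmul := Colligation.inv_sqrt_two_mul_inv_sqrt_two
  rw [Colligation.cayley_one, scatteringColligation, robinColligation, boundaryColligation,
    boundaryColligation]
  congr 1
  · ext z
    change (Real.sqrt 2 : ℂ)⁻¹ • ((Real.sqrt 2 : ℂ)⁻¹ • (a z + b z)
      + (-(Real.sqrt 2 : ℂ)⁻¹) • P (a z - b z)) = (2⁻¹ : ℂ) • ((a z - P (a z)) + (b z + P (b z)))
    rw [map_sub, smul_add, smul_smul, smul_smul, mul_neg, hmul]
    module
  · ext z
    change (Real.sqrt 2 : ℂ)⁻¹ • ((Real.sqrt 2 : ℂ)⁻¹ • (a z + b z)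
      - (-(Real.sqrt 2 : ℂ)⁻¹) • P (a z - b z)) = (2⁻¹ : ℂ) • ((a z + P (a z)) + (b z - P (b z)))
    rw [map_sub, smul_sub, smul_smul, smul_smul, mul_neg, hmul]
    module

namespace IsSkewBoundaryTriple

theorem isInternallyWellPosed_scatteringColligation (h : IsSkewBoundaryTriple L a b) :
    (scatteringColligation L a b P).IsInternallyWellPosed :=
  h.isInternallyWellPosed (P := 0) (norm_zero.trans_le zero_le_one)
    (c := (Real.sqrt 2 : ℂ)⁻¹) (by simp) (fun z => by simp)
    (k := fun p => (-(Real.sqrt 2 : ℂ)⁻¹) • P (p.1 - p.2)) (by fun_prop) fun _ => rfl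

theorem isInternallyWellPosed_robinColligation (h : IsSkewBoundaryTriple L a b) (hP : ‖P‖ ≤ 1) :
    (robinColligation L a b P).IsInternallyWellPosed := by
  refine h.isInternallyWellPosed hP (c := 2⁻¹) (by norm_num) (fun z => ?_)
    (k := fun p => (2⁻¹ : ℂ) • ((1 + P) p.1 + (1 - P) p.2)) (by fun_prop) fun _ => rfl
  change (2⁻¹ : ℂ) • ((a z - P (a z)) + (b z + P (b z))) = _
  rw [map_sub]
  module

theorem scatteringColligation_energy_balance (h : IsSkewBoundaryTriple L a b) (z : L.domain) :
    2 * (inner ℂ (z : H) (L z)).re + (‖a z - b z‖ ^ 2 - ‖P (a z - b z)‖ ^ 2) / 2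
        + ‖(scatteringColligation L a b P).K z‖ ^ 2
      = ‖(scatteringColligation L a b P).G z‖ ^ 2 := by
  have hsqrt : ‖(Real.sqrt 2 : ℂ)⁻¹‖ ^ 2 = 2⁻¹ := by
    rw [norm_inv, Complex.norm_real, inv_pow, Real.norm_of_nonneg (Real.sqrt_nonneg _),
      Real.sq_sqrt zero_le_two]
  have hK : ‖(scatteringColligation L a b P).K z‖ ^ 2 = 2⁻¹ * ‖P (a z - b z)‖ ^ 2 := by
    rw [← hsqrt, ← norm_neg (Real.sqrt 2 : ℂ)⁻¹, ← mul_pow, ← norm_smul]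
    rfl
  have hG : ‖(scatteringColligation L a b P).G z‖ ^ 2 = 2⁻¹ * ‖a z + b z‖ ^ 2 := by
    rw [← hsqrt, ← mul_pow, ← norm_smul]
    rfl
  rw [hK, hG]
  linarith [h.four_mul_re_inner z]

theorem isScatteringPassive_scatteringColligation (h : IsSkewBoundaryTriple L a b)
    (hP : ‖P‖ ≤ 1) : (scatteringColligation L a b P).IsScatteringPassive := by
  refine h.isInternallyWellPosed_scatteringColligation.isScatteringPassive fun z => ?_
  have hPz : ‖P (a z - b z)‖ ≤ ‖a z - b z‖ := (P.le_of_opNorm_le hP _).trans_eq (one_mul _)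
  have hsq := pow_le_pow_left₀ (norm_nonneg _) hPz 2
  have hbalance := h.scatteringColligation_energy_balance (P := P) z
  change 2 * (inner ℂ (z : H) (L z)).re + _ ≤ _
  linarith

theorem isScatteringEnergyPreserving_scatteringColligation (h : IsSkewBoundaryTriple L a b)
    (hP : ∀ u, ‖P u‖ = ‖u‖) : (scatteringColligation L a b P).IsScatteringEnergyPreserving := by
  refine h.isInternallyWellPosed_scatteringColligation.isScatteringEnergyPreserving fun z => ?_
  rw [← h.scatteringColligation_energy_balance z, hP, sub_self, zero_div, add_zero]
  rfl

end IsSkewBoundaryTriple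

end Nodes

theorem AntiDual.inner_riesz_left {H : Type*} [NormedAddCommGroup H] [InnerProductSpace ℂ H]
    [CompleteSpace H] (g : H) (f : AntiDual H) : inner ℂ (riesz H g) f = f g := by
  change inner ℂ ((riesz H).symm (riesz H g)) ((riesz H).symm f) = f g
  rw [LinearIsometryEquiv.symm_apply_apply, ← riesz_apply, LinearIsometryEquiv.apply_symm_apply]

theorem antiDualProd_surjective (G₁ G₂ : Type*) [NormedAddCommGroup G₁] [InnerProductSpace ℂ G₁]
    [NormedAddCommGroup G₂] [InnerProductSpace ℂ G₂] :
    Function.Surjective (antiDualProd G₁ G₂) := fun v => by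
  let e := ((WithLp.prodContinuousLinearEquiv 2 ℂ G₁ G₂).symm : G₁ × G₂ →L[ℂ] WithLp 2 (G₁ × G₂))
  refine ⟨(v.comp (e.comp (ContinuousLinearMap.inl ℂ G₁ G₂)),
    v.comp (e.comp (ContinuousLinearMap.inr ℂ G₁ G₂))), ?_⟩
  ext ⟨g₁, g₂⟩
  change v (e (g₁, 0)) + v (e (0, g₂)) = v (e (g₁, g₂))
  rw [← map_add, ← map_add, Prod.mk_add_mk, add_zero, zero_add]

namespace SecondOrderSystem

variable {X Y G₁ G₂ : Type*}
  [NormedAddCommGroup X] [InnerProductSpace ℂ X] [CompleteSpace X]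
  [NormedAddCommGroup Y] [InnerProductSpace ℂ Y] [CompleteSpace Y]
  [NormedAddCommGroup G₁] [InnerProductSpace ℂ G₁] [CompleteSpace G₁]
  [NormedAddCommGroup G₂] [InnerProductSpace ℂ G₂] [CompleteSpace G₂]

/-- `A` as a linear isometry from the energetic space `X_h` into `Y`. -/
noncomputable def energyIsometry (S : SecondOrderSystem X Y) : S.EnergySpace →ₗᵢ[ℂ] Y :=
  ⟨S.AE, fun _ => rfl⟩

/-- The embedding of the energetic space `X_h = dom A` into `X`, bounded by coercivity of `A`. -/
noncomputable def embed (S : SecondOrderSystem X Y) : S.EnergySpace →L[ℂ] X where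
  toLinearMap := S.A.domain.subtype ∘ₗ S.toDom.toLinearMap
  cont := by
    obtain ⟨c, hc, hA⟩ := S.A_bounded_below
    refine AddMonoidHomClass.continuous_of_bound (S.A.domain.subtype ∘ₗ S.toDom.toLinearMap)
      (Real.sqrt c⁻¹) fun x => ?_
    have hx : ‖(S.toDom x : X)‖ ^ 2 ≤ c⁻¹ * ‖x‖ ^ 2 := by
      rw [← div_eq_inv_mul, le_div_iff₀ hc, mul_comm]
      exact hA (S.toDom x)
    calc ‖(S.toDom x : X)‖ ≤ Real.sqrt (c⁻¹ * ‖x‖ ^ 2) := Real.le_sqrt_of_sq_le hx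
      _ = Real.sqrt c⁻¹ * ‖x‖ := by
        rw [Real.sqrt_mul (inv_nonneg.2 hc.le), Real.sqrt_sq (norm_nonneg x)]

theorem inner_energy (S : SecondOrderSystem X Y) (x v : S.EnergySpace) :
    inner ℂ x v = inner ℂ (S.AE x) (S.AE v) := rfl

/-- The weak form of the surjectivity of `A* A`. -/
theorem exists_inner_embed_eq (S : SecondOrderSystem X Y) (f : X) :
    ∃ x : S.EnergySpace, ∀ v, inner ℂ f (S.embed v) = inner ℂ (S.AE x) (S.AE v) :=
  ⟨S.embed.adjoint f, fun v => by
    rw [← inner_energy, ContinuousLinearMap.adjoint_inner_left]⟩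

theorem exists_inner_AE_eq (S : SecondOrderSystem X Y) (y : Y) :
    ∃ x : S.EnergySpace, ∀ v, inner ℂ (S.AE x) (S.AE v) = inner ℂ y (S.AE v) :=
  ⟨S.energyIsometry.toContinuousLinearMap.adjoint y, fun v => by
    rw [← inner_energy, ContinuousLinearMap.adjoint_inner_left]
    rfl⟩

theorem exists_B_eq_neg (S : SecondOrderSystem X Y) {k : Y} {f : X}
    (h : ∀ x : S.A.domain, inner ℂ f (x : X) = inner ℂ k (S.A x)) :
    ∃ y : S.B.domain, (y : Y) = k ∧ S.B y = -f := by
  have hk : k ∈ (S.A)†.domain := LinearPMap.mem_adjoint_domain_of_exists _ ⟨f, h⟩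
  have hkB : k ∈ S.B.domain := S.adjoint_le.1 hk
  have hAk : (S.A)† ⟨k, hk⟩ = f := LinearPMap.adjoint_apply_eq S.A_dense _ h
  have hABk : (S.A)† ⟨k, hk⟩ = -S.B ⟨k, hkB⟩ := S.adjoint_le.2 (y := ⟨k, hkB⟩) rfl
  exact ⟨⟨k, hkB⟩, rfl, by rw [← hAk, hABk, neg_neg]⟩

theorem mem_graph_A_of_forall_B (S : SecondOrderSystem X Y) {q : X} {p : Y}
    (h : ∀ y : S.B.domain, inner ℂ (y : Y) p + inner ℂ (S.B y) q = 0) : (q, p) ∈ S.A.graph := by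
  refine mem_graph_of_forall_adjoint S.A_closed S.A_dense fun k => ?_
  obtain ⟨y, hy, hBy⟩ := S.exists_B_eq_neg (LinearPMap.adjoint_isFormalAdjoint S.A_dense k)
  have hyk := h y
  rw [hBy, hy, inner_neg_left, ← sub_eq_add_neg, sub_eq_zero] at hyk
  exact hyk.symm

/-- The state in `dom 𝒜` with displacement `x`, whose strain `A x` is `y`, and velocity `v`. -/
def mkState (S : SecondOrderSystem X Y) (x : S.EnergySpace) (y : S.B.domain)
    (hxy : S.AE x = y) (v : S.A.domain) : S.stateDom :=
  ⟨WithLp.toLp 2 (x, (v : X)), (hxy ▸ y.2 : S.AE x ∈ S.B.domain), v.2⟩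

theorem strain_mkState (S : SecondOrderSystem X Y) (x : S.EnergySpace) (y : S.B.domain)
    (hxy : S.AE x = y) (v : S.A.domain) : S.strain (S.mkState x y hxy v) = y :=
  Subtype.ext hxy

theorem velocity_mkState (S : SecondOrderSystem X Y) (x : S.EnergySpace) (y : S.B.domain)
    (hxy : S.AE x = y) (v : S.A.domain) : S.velocity (S.mkState x y hxy v) = v := rfl

theorem coe_strain (S : SecondOrderSystem X Y) (z : S.stateDom) :
    (S.strain z : Y) = S.AE (z : S.StateSpace).fst := rfl

theorem coe_velocity (S : SecondOrderSystem X Y) (z : S.stateDom) :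
    (S.velocity z : X) = (z : S.StateSpace).snd := rfl

theorem inner_stateOp_left (S : SecondOrderSystem X Y) (z : S.stateDom) (w : S.StateSpace) :
    inner ℂ (S.stateOp z) w
      = inner ℂ (S.A (S.velocity z)) (S.AE w.fst) + inner ℂ (S.B (S.strain z)) w.snd := rfl

theorem inner_state_left (S : SecondOrderSystem X Y) (z : S.stateDom) (w : S.StateSpace) :
    inner ℂ (z : S.StateSpace) w
      = inner ℂ (S.strain z : Y) (S.AE w.fst) + inner ℂ (S.velocity z : X) w.snd := rfl

theorem mem_graph_stateOp (S : SecondOrderSystem X Y) {w v : S.StateSpace}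
    (hB : (S.AE w.fst, v.snd) ∈ S.B.graph) (hA : w.snd = S.embed v.fst) :
    (w, v) ∈ S.stateOp.graph := by
  obtain ⟨y, hy : (y : Y) = S.AE w.fst, hBy : S.B y = v.snd⟩ := (LinearPMap.mem_graph_iff _).1 hB
  have hw : w ∈ S.stateDom := ⟨hy ▸ y.2, hA ▸ (S.toDom v.fst).2⟩
  have hstrain : S.strain ⟨w, hw⟩ = y := Subtype.ext hy.symm
  have hvelocity : S.velocity ⟨w, hw⟩ = S.toDom v.fst := Subtype.ext hA
  refine (LinearPMap.mem_graph_iff _).2 ⟨⟨w, hw⟩, rfl, ?_⟩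
  change WithLp.toLp 2 (S.toDom.symm (S.velocity ⟨w, hw⟩), S.B (S.strain ⟨w, hw⟩)) = v
  rw [hvelocity, hstrain, hBy, LinearEquiv.symm_apply_apply]
  rfl

namespace DualPairTriplet

variable {S : SecondOrderSystem X Y}

theorem exists_Lam_eq (T : S.DualPairTriplet G₁ G₂) (g : G₁) (f : AntiDual G₂) :
    ∃ x, T.Lam₁ x = g ∧ T.Lam₂ x = f :=
  (T.Lam_surjective (g, f)).imp fun _ hx => Prod.ext_iff.1 hx

theorem exists_Pi_eq (T : S.DualPairTriplet G₁ G₂) (f : AntiDual G₁) (g : G₂) :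
    ∃ y, T.Pi₁ y = f ∧ T.Pi₂ y = g :=
  (T.Pi_surjective (f, g)).imp fun _ hy => Prod.ext_iff.1 hy

theorem Pi_eq_zero (T : S.DualPairTriplet G₁ G₂) {y : S.B.domain}
    (h : ∀ x : S.A.domain, inner ℂ (x : X) (S.B y) + inner ℂ (S.A x) (y : Y) = 0) :
    T.Pi₁ y = 0 ∧ T.Pi₂ y = 0 := by
  have hpairing (x) : T.Pi₁ y (T.Lam₁ x) - conj (T.Lam₂ x (T.Pi₂ y)) = 0 := by
    rw [← T.green, ← neg_add', h, neg_zero]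
  constructor
  · ext g
    obtain ⟨x, hx₁, hx₂⟩ := T.exists_Lam_eq g 0
    simpa [hx₁, hx₂] using hpairing x
  · obtain ⟨x, hx₁, hx₂⟩ := T.exists_Lam_eq 0 (riesz G₂ (T.Pi₂ y))
    simpa [hx₁, hx₂, riesz_apply] using hpairing x

theorem Lam_eq_zero (T : S.DualPairTriplet G₁ G₂) {x : S.A.domain}
    (h : ∀ y : S.B.domain, inner ℂ (x : X) (S.B y) + inner ℂ (S.A x) (y : Y) = 0) :
    T.Lam₁ x = 0 ∧ T.Lam₂ x = 0 := by
  have hpairing (y) : T.Pi₁ y (T.Lam₁ x) - conj (T.Lam₂ x (T.Pi₂ y)) = 0 := by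
    rw [← T.green, ← neg_add', h, neg_zero]
  constructor
  · obtain ⟨y, hy₁, hy₂⟩ := T.exists_Pi_eq (riesz G₁ (T.Lam₁ x)) 0
    simpa [hy₁, hy₂, riesz_apply] using hpairing y
  · ext g
    obtain ⟨y, hy₁, hy₂⟩ := T.exists_Pi_eq 0 g
    simpa [hy₁, hy₂] using hpairing y

theorem exists_B_eq_neg_and_Pi_eq_zero (T : S.DualPairTriplet G₁ G₂) {k : Y} {f : X}
    (h : ∀ x : S.A.domain, inner ℂ f (x : X) = inner ℂ k (S.A x)) :
    ∃ y : S.B.domain, (y : Y) = k ∧ S.B y = -f ∧ T.Pi₁ y = 0 ∧ T.Pi₂ y = 0 := by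
  obtain ⟨y, rfl, hBy⟩ := S.exists_B_eq_neg h
  refine ⟨y, rfl, hBy, T.Pi_eq_zero fun x => ?_⟩
  rw [hBy, inner_neg_right, ← inner_conj_symm, h, inner_conj_symm, neg_add_cancel]

/-- Projecting `y` onto `ran A` changes it by an element of `ker A*`, where `Π` vanishes. -/
theorem exists_AE_eq_and_Pi_eq (T : S.DualPairTriplet G₁ G₂) (f : AntiDual G₁) (g : G₂) :
    ∃ (x : S.EnergySpace) (y : S.B.domain), S.AE x = y ∧ T.Pi₁ y = f ∧ T.Pi₂ y = g := by
  obtain ⟨y, hy₁, hy₂⟩ := T.exists_Pi_eq f g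
  obtain ⟨x, hx⟩ := S.exists_inner_AE_eq y
  have horth (v : S.A.domain) : inner ℂ (0 : X) (v : X) = inner ℂ ((y : Y) - S.AE x) (S.A v) := by
    rw [inner_zero_left, inner_sub_left, eq_comm, sub_eq_zero]
    exact (hx (S.toDom.symm v)).symm
  obtain ⟨k, hk, -, hk₁, hk₂⟩ := T.exists_B_eq_neg_and_Pi_eq_zero horth
  refine ⟨x, y - k, ?_, ?_, ?_⟩
  · rw [Submodule.coe_sub, hk, sub_sub_cancel]
  · rw [map_sub, hy₁, hk₁, sub_zero]
  · rw [map_sub, hy₂, hk₂, sub_zero]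

theorem mem_graph_B_of_forall_Lam_eq_zero (T : S.DualPairTriplet G₁ G₂) {p : Y} {q : X}
    (h : ∀ x, T.Lam₁ x = 0 → T.Lam₂ x = 0 → inner ℂ (S.A x) p = -inner ℂ (x : X) q) :
    (p, q) ∈ S.B.graph := by
  refine mem_graph_of_forall_adjoint S.B_closed S.B_dense fun k => ?_
  have hBk (y : S.B.domain) :
      inner ℂ (y : Y) (-(S.B)† k) + inner ℂ (S.B y) (k : X) = 0 := by
    rw [(LinearPMap.adjoint_isFormalAdjoint S.B_dense).symm y k, inner_neg_right, neg_add_cancel]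
  obtain ⟨x, hx : (x : X) = k, hAx : S.A x = -(S.B)† k⟩ :=
    (LinearPMap.mem_graph_iff _).1 (S.mem_graph_A_of_forall_B hBk)
  rw [← hx, ← hAx] at hBk
  obtain ⟨hx₁, hx₂⟩ := T.Lam_eq_zero (x := x) fun y => by
    simpa [add_comm] using congrArg conj (hBk y)
  simpa [hx, hAx] using h x hx₁ hx₂

theorem eq_embed_of_forall_Pi_eq_zero (T : S.DualPairTriplet G₁ G₂) {q : X} {e : S.EnergySpace}
    (h : ∀ (x : S.EnergySpace) (y : S.B.domain), S.AE x = y → T.Pi₁ y = 0 → T.Pi₂ y = 0 →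
      inner ℂ (S.B y) q = -inner ℂ (y : Y) (S.AE e)) : q = S.embed e := by
  refine ext_inner_left ℂ fun f => ?_
  obtain ⟨x, hx⟩ := S.exists_inner_embed_eq f
  obtain ⟨y, hy, hBy, hy₁, hy₂⟩ :=
    T.exists_B_eq_neg_and_Pi_eq_zero fun v => hx (S.toDom.symm v)
  rw [hx, ← neg_inj, ← inner_neg_left, ← hBy, h x y hy.symm hy₁ hy₂, hy]

theorem RΓ₀_apply (T : S.DualPairTriplet G₁ G₂) (z : S.stateDom) :
    T.RΓ₀ z = riesz _ (WithLp.toLp 2 (T.Lam₁ (S.velocity z), T.Pi₂ (S.strain z))) := rfl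

theorem Γ₁_apply (T : S.DualPairTriplet G₁ G₂) (z : S.stateDom) :
    T.Γ₁ z = antiDualProd G₁ G₂ (-T.Pi₁ (S.strain z), T.Lam₂ (S.velocity z)) := rfl

theorem inner_RΓ₀_Γ₁ (T : S.DualPairTriplet G₁ G₂) (z w : S.stateDom) :
    inner ℂ (T.RΓ₀ z) (T.Γ₁ w) = -T.Pi₁ (S.strain w) (T.Lam₁ (S.velocity z))
      + T.Lam₂ (S.velocity w) (T.Pi₂ (S.strain z)) := by
  rw [RΓ₀_apply, AntiDual.inner_riesz_left]
  rfl

theorem green_stateOp (T : S.DualPairTriplet G₁ G₂) (z w : S.stateDom) :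
    inner ℂ (S.stateOp z) (w : S.StateSpace) + inner ℂ (z : S.StateSpace) (S.stateOp w)
      = inner ℂ (T.RΓ₀ z) (T.Γ₁ w) + inner ℂ (T.Γ₁ z) (T.RΓ₀ w) := by
  rw [← inner_conj_symm (T.Γ₁ z), ← inner_conj_symm (z : S.StateSpace), inner_RΓ₀_Γ₁,
    inner_RΓ₀_Γ₁, inner_stateOp_left, inner_stateOp_left]
  have hwz := T.green (S.strain w) (S.velocity z)
  have hzw := congrArg conj (T.green (S.strain z) (S.velocity w))
  simp only [map_sub, map_neg, map_add, inner_conj_symm, Complex.conj_conj] at hwz hzw ⊢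
  simp only [coe_strain, coe_velocity] at hwz hzw
  linear_combination -hwz - hzw

theorem exists_boundary_eq (T : S.DualPairTriplet G₁ G₂) (u v : AntiDual (WithLp 2 (G₁ × G₂))) :
    ∃ z, T.RΓ₀ z = u ∧ T.Γ₁ z = v := by
  obtain ⟨⟨g₁, g₂⟩, rfl⟩ := (riesz (WithLp 2 (G₁ × G₂))).surjective u
  obtain ⟨⟨f₁, f₂⟩, rfl⟩ := antiDualProd_surjective G₁ G₂ v
  obtain ⟨x, hx₁, hx₂⟩ := T.exists_Lam_eq g₁ f₂
  obtain ⟨e, y, hey, hy₁, hy₂⟩ := T.exists_AE_eq_and_Pi_eq (-f₁) g₂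
  refine ⟨S.mkState e y hey x, ?_, ?_⟩
  · rw [RΓ₀_apply, velocity_mkState, strain_mkState, hx₁, hy₂]
  · rw [Γ₁_apply, velocity_mkState, strain_mkState, hx₂, hy₁, neg_neg]

theorem boundary_eq_zero (T : S.DualPairTriplet G₁ G₂) {z : S.stateDom}
    (hLam : T.Lam₁ (S.velocity z) = 0 ∧ T.Lam₂ (S.velocity z) = 0)
    (hPi : T.Pi₁ (S.strain z) = 0 ∧ T.Pi₂ (S.strain z) = 0) : T.RΓ₀ z = 0 ∧ T.Γ₁ z = 0 := by
  rw [RΓ₀_apply, Γ₁_apply, hLam.1, hLam.2, hPi.1, hPi.2, neg_zero]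
  exact ⟨map_zero _, map_zero _⟩

theorem mem_graph_stateOp_of_forall_boundary_eq_zero (T : S.DualPairTriplet G₁ G₂)
    {w v : S.StateSpace} (h : ∀ z : S.stateDom, T.RΓ₀ z = 0 → T.Γ₁ z = 0 →
      inner ℂ (S.stateOp z) w = -inner ℂ (z : S.StateSpace) v) : (w, v) ∈ S.stateOp.graph := by
  have hinner (x : S.EnergySpace) (y : S.B.domain) (hxy : S.AE x = y)
      (a : S.A.domain) (hPi : T.Pi₁ y = 0 ∧ T.Pi₂ y = 0)
      (hLam : T.Lam₁ a = 0 ∧ T.Lam₂ a = 0) :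
      inner ℂ (S.A a) (S.AE w.fst) + inner ℂ (S.B y) w.snd
        = -(inner ℂ (y : Y) (S.AE v.fst) + inner ℂ (a : X) v.snd) := by
    obtain ⟨hz₀, hz₁⟩ := T.boundary_eq_zero (z := S.mkState x y hxy a) hLam
      (by rwa [strain_mkState])
    have hz := h _ hz₀ hz₁
    rwa [inner_stateOp_left, inner_state_left, strain_mkState, velocity_mkState] at hz
  refine S.mem_graph_stateOp (T.mem_graph_B_of_forall_Lam_eq_zero fun a ha₁ ha₂ => ?_)
    (T.eq_embed_of_forall_Pi_eq_zero fun x y hxy hy₁ hy₂ => ?_)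
  · simpa [LinearPMap.map_zero] using
      hinner 0 0 (map_zero _) a ⟨map_zero _, map_zero _⟩ ⟨ha₁, ha₂⟩
  · simpa [LinearPMap.map_zero] using
      hinner x y hxy 0 ⟨hy₁, hy₂⟩ ⟨map_zero _, map_zero _⟩

theorem isSkewBoundaryTriple (T : S.DualPairTriplet G₁ G₂) :
    IsSkewBoundaryTriple S.stateOp T.RΓ₀ T.Γ₁ where
  green := T.green_stateOp
  surjective := T.exists_boundary_eq
  maximal _ _ := T.mem_graph_stateOp_of_forall_boundary_eq_zero

end DualPairTriplet

end SecondOrderSystem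

theorem corollary3p8_general {X Y G₁ G₂ : Type*}
    [NormedAddCommGroup X] [InnerProductSpace ℂ X] [CompleteSpace X]
    [NormedAddCommGroup Y] [InnerProductSpace ℂ Y] [CompleteSpace Y]
    [NormedAddCommGroup G₁] [InnerProductSpace ℂ G₁] [CompleteSpace G₁]
    [NormedAddCommGroup G₂] [InnerProductSpace ℂ G₂] [CompleteSpace G₂]
    (S : SecondOrderSystem X Y) (T : S.DualPairTriplet G₁ G₂)
    (P : AntiDual (WithLp 2 (G₁ × G₂)) →L[ℂ] AntiDual (WithLp 2 (G₁ × G₂))) :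
    (S.stateOp)†† = S.stateOp ∧
    (T.scatteringNode P).cayley 1 = T.robinNode P ∧
    (‖P‖ ≤ 1 →
      ((T.scatteringNode P).cayley 1).IsInternallyWellPosed ∧
      ((T.scatteringNode P).cayley 1).IsImpedancePassive) ∧
    ((∀ f, ‖P f‖ = ‖f‖) → ((T.scatteringNode P).cayley 1).IsImpedanceEnergyPreserving) := by
  have hT := T.isSkewBoundaryTriple
  have hcayley : (T.scatteringNode P).cayley 1 = T.robinNode P :=
    scatteringColligation_cayley_one (L := S.stateOp) (a := T.RΓ₀) (b := T.Γ₁)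
  refine ⟨adjoint_adjoint_eq_self hT.isClosed hT.dense_domain, hcayley, fun hP => ⟨?_, ?_⟩,
    fun hP => ?_⟩
  · rw [hcayley]
    exact hT.isInternallyWellPosed_robinColligation hP
  · exact (hT.isScatteringPassive_scatteringColligation hP).isImpedancePassive_cayley_one
  · exact (hT.isScatteringEnergyPreserving_scatteringColligation
      hP).isImpedanceEnergyPreserving_cayley_one

theorem corollary3p8 {X Y G₁ G₂ : Type*}
    [NormedAddCommGroup X] [InnerProductSpace ℂ X] [CompleteSpace X]
    [NormedAddCommGroup Y] [InnerProductSpace ℂ Y] [CompleteSpace Y]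
    [NormedAddCommGroup G₁] [InnerProductSpace ℂ G₁] [CompleteSpace G₁]
    [NormedAddCommGroup G₂] [InnerProductSpace ℂ G₂] [CompleteSpace G₂]
    (S : SecondOrderSystem X Y) (T : S.DualPairTriplet G₁ G₂)
    (P : AntiDual (WithLp 2 (G₁ × G₂)) →L[ℂ] AntiDual (WithLp 2 (G₁ × G₂))) :
    (S.stateOp)†† = S.stateOp ∧
    (T.scatteringNode P).cayley 1 = T.robinNode P ∧
    (‖P‖ ≤ 1 →
      ((T.scatteringNode P).cayley 1).IsInternallyWellPosed ∧
      ((T.scatteringNode P).cayley 1).IsImpedancePassive) ∧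
    (P ∈ unitary (AntiDual (WithLp 2 (G₁ × G₂)) →L[ℂ] AntiDual (WithLp 2 (G₁ × G₂))) →
      ((T.scatteringNode P).cayley 1).IsImpedanceEnergyPreserving) := by
  obtain ⟨hadjoint, hcayley, hpassive, hpreserving⟩ := corollary3p8_general S T P
  exact ⟨hadjoint, hcayley, hpassive,
    fun hP => hpreserving fun f => ContinuousLinearMap.norm_map_of_mem_unitary hP f⟩
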